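/- Let $N\ge 3$. Consider a ring of $N$ processes, numbered $1,\dots,N$ clockwise. A configuration $z$ consists of an odd number $K\ge 1$ of tokens, held by distinct processes $z(1)<\dots<z(K)$. In one synchronous step of Herman's protocol every process that holds a token, independently and with probability $\frac12$ each, keeps it or passes it to its clockwise neighbour; if a process then has two tokens (one kept and one received), both are annihilated. Let $z'$ be the random configuration obtained from $z$ in one step, let $(z_t)_{t\ge 0}$ be the process obtained from $z_0=z$ by iterating such steps independently, and let $T_z=\min\{t\ge 0 : z_t \text{ has exactly one token}\}$ (with $\min\emptyset=\infty$). The gap vector of $z$ is $\vec g(z)=(g_0,\dots,g_{K-1})$ with $g_0=N+z(1)-z(K)$ and $g_i=z(i+1)-z(i)$ for $1\le i\le K-1$. For $\vec x=(x_0,\dots,x_{K-1})$ put $$f_3(\vec x)=\sum x_{i_0}x_{i_1}x_{i_2},\qquad f_5(\vec x)=\sum x_{i_0}x_{i_1}x_{i_2}x_{i_3}x_{i_4},\qquad f(\vec x)=f_3(\vec x)-24\,f_5(\vec x),$$ where the sums range over $0\le i_0<i_1<i_2<K$ and $0\le i_0<i_1<i_2<i_3<i_4<K$, respectively, such that all differences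 of consecutive indices $i_{j+1}-i_j$ are odd. Let $$V(z)=4N^2 f\bigl(\vec g(z)/N\bigr).$$ Then: 1. $V(z)\ge 0$ for every configuration $z$; 2. $\mathbb E\bigl(V(z')\mid z\bigr)\le V(z)-1$ for every configuration $z$ with at least three tokens; 3. $\mathbb E\,T_z\le V(z)=4N^2 f\bigl(\vec g(z)/N\bigr)$ for every configuration $z$ (in particular this expectation is finite). -/

import Mathlib

open MeasureTheory
open scoped ENNReal symmDiff

namespace Herman

/-- A configuration of the ring of `N` processes (numbered `0, …, N - 1` clockwise): the set of
processes that hold a token; the number of tokens is odd. -/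
def Config (N : ℕ) : Type := {s : Finset (Fin N) // Odd s.card}

variable {N : ℕ}

/-- The set of token-holding processes. -/
def Config.tokens (z : Config N) : Finset (Fin N) := z.1

/-- The number `K` of tokens. -/
def Config.K (z : Config N) : ℕ := z.tokens.card

theorem Config.odd_K (z : Config N) : Odd z.K := z.2

/-- The configuration as a strictly increasing function: `z.pos i` is the process that holds the
`i`-th token, the tokens being numbered `0, …, K - 1` in increasing order of their position. -/
def Config.pos (z : Config N) : Fin z.K ↪o Fin N := z.tokens.orderEmbOfFin rfl

/-- The gap vector `(g_0, …, g_{K-1})`: `g_0` is the clockwise distance from the last token to the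
first one, and `g_i`, for `i ≥ 1`, the distance between the tokens `i - 1` and `i` (in the numbering
that starts with `0`). No subtraction of natural numbers is truncated here. -/
def Config.gap (z : Config N) (i : Fin z.K) : ℕ :=
  if (i : ℕ) = 0 then
    N + (z.pos ⟨0, z.odd_K.pos⟩ : ℕ) - (z.pos ⟨z.K - 1, Nat.sub_lt z.odd_K.pos one_pos⟩ : ℕ)
  else
    (z.pos i : ℕ) - (z.pos ⟨(i : ℕ) - 1, lt_of_le_of_lt (Nat.sub_le _ _) i.isLt⟩ : ℕ)

/-- The tokens that are kept, when exactly the processes `p` with `b p = true` pass their token. -/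
def keptTokens (s : Finset (Fin N)) (b : Fin N → Bool) : Finset (Fin N) :=
  s.filter (fun p => b p = false)

/-- The processes that receive a token from their counterclockwise neighbour, when exactly the
processes `p` with `b p = true` pass their token (if they hold one). The permutation `finRotate N`
sends each process to its clockwise neighbour. -/
def receivedTokens (s : Finset (Fin N)) (b : Fin N → Bool) : Finset (Fin N) :=
  (s.filter (fun p => b p = true)).map (finRotate N).toEmbedding

theorem odd_card_step (s : Finset (Fin N)) (hs : Odd s.card) (b : Fin N → Bool) :
    Odd (keptTokens s b ∆ receivedTokens s b).card := by
  have h1 : (keptTokens s b).card + (receivedTokens s b).card = s.card := by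
    have h := Finset.card_filter_add_card_filter_not (s := s) (fun p => b p = false)
    simpa [keptTokens, receivedTokens] using h
  have h2 := Finset.card_sdiff_add_card_inter (keptTokens s b) (receivedTokens s b)
  have h3 := Finset.card_sdiff_add_card_inter (receivedTokens s b) (keptTokens s b)
  rw [Finset.inter_comm] at h3
  have h4 : (keptTokens s b ∆ receivedTokens s b).card
      = (keptTokens s b \ receivedTokens s b).card
        + (receivedTokens s b \ keptTokens s b).card := by
    rw [symmDiff_def, Finset.sup_eq_union]
    exact Finset.card_union_of_disjoint disjoint_sdiff_sdiff
  rw [h4]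
  rw [Nat.odd_iff] at hs ⊢
  omega

/-- One synchronous step of the protocol with the coin flips `b`: a token at `p` is passed to the
clockwise neighbour of `p` if `b p = true` and stays at `p` otherwise; then two tokens at the same
process (one kept, one received) annihilate each other. -/
def Config.step (z : Config N) (b : Fin N → Bool) : Config N :=
  ⟨keptTokens z.tokens b ∆ receivedTokens z.tokens b, odd_card_step z.tokens z.2 b⟩

/-- The law of one round of independent fair coin flips, one per process. -/
noncomputable def coins (N : ℕ) : Measure (Fin N → Bool) :=
  (PMF.uniformOfFintype (Fin N → Bool)).toMeasure

instance (N : ℕ) : IsProbabilityMeasure (coins N) := by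
  unfold coins; infer_instance

/-- The law of infinitely many independent rounds of coin flips. -/
noncomputable def coinSequence (N : ℕ) : Measure (ℕ → Fin N → Bool) :=
  Measure.infinitePi (fun _ : ℕ => coins N)

/-- The process `(z_t)` emanating from `z`, with `ω t` the coin flips of the round from `t` to
`t + 1`. -/
def Config.process (z : Config N) (ω : ℕ → Fin N → Bool) : ℕ → Config N
  | 0 => z
  | t + 1 => (z.process ω t).step (ω t)

/-- The stabilization time `T_z`: the least `t` such that `z_t` has one token only (`∞` if there is
no such `t`). -/
noncomputable def Config.stabilizationTime (z : Config N) (ω : ℕ → Fin N → Bool) : ℝ≥0∞ :=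
  ⨅ (t : ℕ) (_ : (z.process ω t).K = 1), (t : ℝ≥0∞)

/-- The expected stabilization time `E T_z`, an element of `[0, ∞]`. -/
noncomputable def Config.expectedTime (z : Config N) : ℝ≥0∞ :=
  ∫⁻ ω, z.stabilizationTime ω ∂(coinSequence N)

/-- The expectation `E (W (z') | z)` for the random successor configuration `z'` of `z`. -/
noncomputable def Config.successorExpectation (z : Config N) (W : Config N → ℝ) : ℝ :=
  ∫ b, W (z.step b) ∂(coins N)

/-- The sum of all monomials `x_{i_0} ⋯ x_{i_{m-1}}` over `0 ≤ i_0 < ⋯ < i_{m-1} < K` such that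
all differences of consecutive indices are odd. -/
def alternatingSum (m K : ℕ) (x : Fin K → ℝ) : ℝ :=
  ∑ i : Fin m → Fin K with
    ∀ j k : Fin m, (k : ℕ) = (j : ℕ) + 1 → i j < i k ∧ Odd ((i k : ℕ) - (i j : ℕ)),
    ∏ j, x (i j)

/-- The cubic polynomial `f_3`. -/
def f₃ {K : ℕ} (x : Fin K → ℝ) : ℝ := alternatingSum 3 K x

/-- The quintic polynomial `f_5`. -/
def f₅ {K : ℕ} (x : Fin K → ℝ) : ℝ := alternatingSum 5 K x

/-- The polynomial `f = f_3 - 24 f_5`. -/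
def f {K : ℕ} (x : Fin K → ℝ) : ℝ := f₃ x - 24 * f₅ x

/-- The Lyapunov function `V(z) = 4 N² f(g(z) / N)`. -/
noncomputable def V (z : Config N) : ℝ :=
  4 * (N : ℝ) ^ 2 * f (fun i : Fin z.K => (z.gap i : ℝ) / (N : ℝ))

end Herman

/-! Let `p → q` if the clockwise arc `[p, q)` holds an odd number of tokens. As `K` is odd, this is
a tournament on the processes. Call a tuple cyclic if any three cyclically consecutive entries form
a cyclic triangle, and let `c₃`, `c₅` count the cyclic 3- and 5-tuples. Then `c₃ = 3 f₃(g)` and `c₅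
= 5 f₅(g)`, so `V = 4 c₃ / (3N) - 96 c₅ / (5N³)` (`V_eq`).

One step pulls the tournament back along the random map `pull b`, which sends each process to itself
or to its predecessor (`rel_stepSet`). Two processes with the same image are twins and lie in no
common cyclic triangle. So a cyclic tuple is lost only if one entry moves onto a clockwise neighbour
that stays, an event of probability 1/4 for each neighbouring pair. With `a₃`, `a₅` the numbers of
cyclic tuples such that `q 1` is the clockwise neighbour of `q 0`, this gives `E c₃' ≤ c₃ - (3/4)
a₃` and `E c₅' ≥ c₅ - (5/4) a₅`.

Three counts finish the drift bound: `a₃ ≥ N(K-1)/2`, `a₅ ≤ (K-3) c₃ / 6` and `c₃ ≤ N³/8`. The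
expected change of `V` is then at most `-(K-1)/2 + (K-3)/2 = -1` for `K ≥ 3`. Nonnegativity comes
from `c₅ ≤ N² c₃ / 16`, and the bound on `E T` from summing the drift over time. -/

namespace Herman

/-! ### The tournament of a configuration -/

variable {N : ℕ}

/-- The number of tokens at processes with a number below `n`. -/
def cnt (s : Finset (Fin N)) (n : ℕ) : ℕ := (s.filter (fun x : Fin N => (x : ℕ) < n)).card

/-- The tournament on the processes that is defined by a configuration: `p → q` if the clockwise
arc from `p` (included) to `q` (excluded) holds an odd number of tokens. -/
def Rel (s : Finset (Fin N)) (p q : Fin N) : Prop := p ≠ q ∧ (p < q ↔ Odd (cnt s p + cnt s q))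

/-- Cyclic triangles of the tournament. -/
def Tri (s : Finset (Fin N)) (p q r : Fin N) : Prop := Rel s p q ∧ Rel s q r ∧ Rel s r p

/-- The tuples in which any three cyclically consecutive entries form a cyclic triangle. -/
def Cyc {m : ℕ} [NeZero m] (s : Finset (Fin N)) (q : Fin m → Fin N) : Prop :=
  ∀ i, Tri s (q i) (q (i + 1)) (q (i + 2))

theorem rel_iff {s : Finset (Fin N)} {p q : Fin N} :
    Rel s p q ↔ (p : ℕ) ≠ q ∧ ((p : ℕ) < q ↔ (cnt s p + cnt s q) % 2 = 1) := by
  rw [Rel, Ne, Fin.ext_iff, Nat.odd_iff, Fin.lt_def]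

theorem not_rel_self (s : Finset (Fin N)) (p : Fin N) : ¬ Rel s p p := fun h => h.1 rfl

theorem rel_comm {s : Finset (Fin N)} {p q : Fin N} (h : p ≠ q) : Rel s q p ↔ ¬ Rel s p q := by
  rw [Ne, Fin.ext_iff] at h
  rw [rel_iff, rel_iff]
  omega

theorem Rel.asymm {s : Finset (Fin N)} {p q : Fin N} (h : Rel s p q) : ¬ Rel s q p := by
  rw [rel_comm h.1]; exact not_not.2 h

theorem Tri.rotate {s : Finset (Fin N)} {p q r : Fin N} (h : Tri s p q r) : Tri s q r p :=
  ⟨h.2.1, h.2.2, h.1⟩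

theorem cnt_zero (s : Finset (Fin N)) : cnt s 0 = 0 := by simp [cnt]

theorem cnt_top (s : Finset (Fin N)) : cnt s N = s.card := by
  simp [cnt, Finset.filter_true_of_mem]

theorem cnt_mono (s : Finset (Fin N)) : Monotone (cnt s) := fun a b h => by
  apply Finset.card_le_card
  intro x
  simp only [Finset.mem_filter]
  exact fun hx => ⟨hx.1, hx.2.trans_le h⟩

theorem cnt_succ (s : Finset (Fin N)) (x : Fin N) :
    cnt s (x + 1) = cnt s x + if x ∈ s then 1 else 0 := by
  have h : s.filter (fun y : Fin N => (y : ℕ) < x + 1)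
      = s.filter (fun y : Fin N => (y : ℕ) < x) ∪ s.filter (fun y : Fin N => y = x) := by
    ext y
    simp only [Finset.mem_filter, Finset.mem_union, Fin.ext_iff, ← and_or_left]
    refine and_congr_right fun _ => ?_
    omega
  rw [cnt, h, Finset.card_union_of_disjoint, cnt, Finset.filter_eq']
  · congr 1
    split_ifs <;> simp
  · rw [Finset.disjoint_left]
    intro y hy hy'
    simp only [Finset.mem_filter, Fin.ext_iff] at hy hy'
    omega

theorem val_finRotate (p : Fin N) :
    (finRotate N p : ℕ) = if (p : ℕ) + 1 = N then 0 else (p : ℕ) + 1 := by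
  obtain _ | n := N
  · exact p.elim0
  · split_ifs with h
    · have : p = Fin.last n := by ext; simpa using h
      rw [this, finRotate_last]; rfl
    · exact coe_finRotate_of_ne_last (fun h' => h (by rw [h']; rfl))

theorem rel_finRotate {s : Finset (Fin N)} (hN : 2 ≤ N) (hs : Odd s.card) (x : Fin N) :
    Rel s x (finRotate N x) ↔ x ∈ s := by
  have h1 := val_finRotate x
  have h2 := cnt_succ s x
  have h3 := cnt_top s
  have h4 := cnt_zero s
  have h5 := x.2
  rw [Nat.odd_iff] at hs
  rw [rel_iff]
  by_cases hx : (x : ℕ) + 1 = N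
  · rw [if_pos hx] at h1
    rw [h1, h4]
    rw [hx] at h2
    split_ifs at h2 with hxs <;> simp only [hxs, iff_true, iff_false] <;> omega
  · rw [if_neg hx] at h1
    rw [h1]
    split_ifs at h2 with hxs <;> simp only [hxs, iff_true, iff_false] <;> omega

/-- Advancing the end of an arc past `x` adds the process `x` to it, so the parity flips exactly if
`x` holds a token. -/
theorem rel_finRotate_right {s : Finset (Fin N)} (hs : Odd s.card) {w x : Fin N} (h : w ≠ x)
    (h' : w ≠ finRotate N x) : Rel s w (finRotate N x) ↔ (Rel s w x ↔ x ∉ s) := by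
  have h1 := val_finRotate x
  have h2 := cnt_succ s x
  have h3 := cnt_top s
  have h4 := cnt_zero s
  have h5 := x.2
  have h6 := w.2
  rw [Nat.odd_iff] at hs
  rw [Ne, Fin.ext_iff] at h h'
  rw [rel_iff, rel_iff]
  by_cases hx : (x : ℕ) + 1 = N
  · rw [if_pos hx] at h1
    rw [h1] at h' ⊢
    rw [h4]
    rw [hx] at h2
    split_ifs at h2 with hxs <;> simp only [hxs, not_true, not_false_eq_true, iff_true, iff_false]
      <;> omega
  · rw [if_neg hx] at h1
    rw [h1] at h' ⊢
    split_ifs at h2 with hxs <;> simp only [hxs, not_true, not_false_eq_true, iff_true, iff_false]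
      <;> omega

/-- The vertices of a cyclic triangle neither all beat a given vertex nor do they all lose
against it. -/
theorem Tri.one_or_two {s : Finset (Fin N)} {p q r : Fin N} (h : Tri s p q r) (x : Fin N) :
    (Rel s p x ∨ Rel s q x ∨ Rel s r x) ∧ ¬ (Rel s p x ∧ Rel s q x ∧ Rel s r x) := by
  obtain ⟨h1, h2, h3⟩ := h
  rw [rel_iff] at h1 h2 h3
  simp only [rel_iff]
  by_cases hp : x = p
  · subst hp; omega
  by_cases hq : x = q
  · subst hq; omega
  by_cases hr : x = r
  · subst hr; omega
  rw [Fin.ext_iff] at hp hq hr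
  generalize cnt s p = a at *
  generalize cnt s q = b at *
  generalize cnt s r = c at *
  generalize cnt s x = d at *
  -- By parity, `p, q, r` occur in clockwise order with all three arcs odd. If `x` lies strictly
  -- between `p` and `q`, then `p` and `q` relate to `x` alike and `r` relates to it oppositely.
  rcases Nat.lt_or_gt_of_ne h1.1 with h11 | h11 <;> rcases Nat.lt_or_gt_of_ne h2.1 with h22 | h22 <;>
    rcases Nat.lt_or_gt_of_ne h3.1 with h33 | h33 <;> rcases Nat.lt_or_gt_of_ne hp with hpp | hpp <;>
    rcases Nat.lt_or_gt_of_ne hq with hqq | hqq <;> rcases Nat.lt_or_gt_of_ne hr with hrr | hrr <;>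
    omega

/-- Along the tokens in increasing order, `cnt s` takes the values 0, 1, 2, … once each. -/
theorem card_tokens_odd_even (s : Finset (Fin N)) (n : ℕ) (hn : n ≤ N) :
    (s.filter (fun x : Fin N => (x : ℕ) < n ∧ cnt s x % 2 = 1)).card = cnt s n / 2 ∧
    (s.filter (fun x : Fin N => (x : ℕ) < n ∧ cnt s x % 2 = 0)).card = (cnt s n + 1) / 2 := by
  induction n with
  | zero => simp [cnt_zero]
  | succ n ih =>
    have key : ∀ P : Fin N → Prop, [DecidablePred P] →
        (s.filter (fun x : Fin N => (x : ℕ) < n + 1 ∧ P x)).card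
          = (s.filter (fun x : Fin N => (x : ℕ) < n ∧ P x)).card
            + if (⟨n, hn⟩ : Fin N) ∈ s ∧ P ⟨n, hn⟩ then 1 else 0 := by
      intro P _
      have h : s.filter (fun y : Fin N => (y : ℕ) < n + 1 ∧ P y)
          = s.filter (fun y : Fin N => (y : ℕ) < n ∧ P y)
            ∪ (s.filter (fun y : Fin N => P y)).filter (fun y : Fin N => y = ⟨n, hn⟩) := by
        ext y
        simp only [Finset.mem_filter, Finset.mem_union, Fin.ext_iff, Order.lt_add_one_iff,
          le_iff_lt_or_eq]
        tauto
      rw [h, Finset.card_union_of_disjoint, Finset.filter_eq']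
      · congr 1
        simp only [Finset.mem_filter]
        split_ifs <;> simp
      · rw [Finset.disjoint_left]
        intro y hy hy'
        simp only [Finset.mem_filter, Fin.ext_iff] at hy hy'
        omega
    obtain ⟨ih1, ih2⟩ := ih (by omega)
    have hc := cnt_succ s ⟨n, hn⟩
    simp only at hc
    rw [key, key, ih1, ih2]
    simp only
    by_cases hm : (⟨n, hn⟩ : Fin N) ∈ s <;>
      simp only [hm, true_and, false_and, if_true, if_false] at hc ⊢ <;> (try split_ifs) <;> omega

/-- Going clockwise from `r`, the parity of the arc up to a token alternates, starting with even; so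
`r` beats the second, fourth, … of the `K` tokens. -/
theorem card_rel_tokens {s : Finset (Fin N)} (hs : Odd s.card) (r : Fin N)
    [DecidablePred (Rel s r)] :
    (s.filter (fun x : Fin N => Rel s r x)).card = (s.card - 1) / 2 := by
  obtain ⟨a1, a2⟩ := card_tokens_odd_even s r r.2.le
  obtain ⟨b1, b2⟩ := card_tokens_odd_even s N le_rfl
  rw [cnt_top] at b1 b2
  rw [Nat.odd_iff] at hs
  have split : ∀ i, (s.filter (fun x : Fin N => (x : ℕ) < N ∧ cnt s x % 2 = i)).card =
      (s.filter (fun x : Fin N => (x : ℕ) < r ∧ cnt s x % 2 = i)).card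
        + (s.filter (fun x : Fin N => ¬ (x : ℕ) < r ∧ cnt s x % 2 = i)).card := by
    intro i
    rw [← Finset.card_union_of_disjoint]
    · congr 1
      ext x
      simp only [Finset.mem_filter, Finset.mem_union]
      have := x.2
      tauto
    · rw [Finset.disjoint_left]
      intro y hy hy'
      simp only [Finset.mem_filter] at hy hy'
      omega
  have h0 := split 0
  have h1 := split 1
  -- A token before `r` is beaten if its count has the parity `i` of `cnt s r`, a later one if it
  -- has the opposite parity `j`.
  obtain ⟨i, j, hij, hi⟩ : ∃ i j, i + j = 1 ∧ cnt s r % 2 = i := by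
    rcases Nat.mod_two_eq_zero_or_one (cnt s r) with h | h
    · exact ⟨0, 1, rfl, h⟩
    · exact ⟨1, 0, rfl, h⟩
  have h : s.filter (fun x : Fin N => Rel s r x)
      = s.filter (fun x : Fin N => (x : ℕ) < r ∧ cnt s x % 2 = i)
      ∪ s.filter (fun x : Fin N => ¬ (x : ℕ) < r ∧ cnt s x % 2 = j) := by
    ext x
    simp only [Finset.mem_filter, Finset.mem_union, ← and_or_left, rel_iff]
    refine and_congr_right fun _ => ?_
    by_cases hx : x = r
    · subst hx; omega
    · rw [Fin.ext_iff] at hx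
      omega
  rw [h, Finset.card_union_of_disjoint]
  · rcases Nat.mod_two_eq_zero_or_one (cnt s r) with h' | h'
    · obtain ⟨rfl, rfl⟩ : i = 0 ∧ j = 1 := by omega
      omega
    · obtain ⟨rfl, rfl⟩ : i = 1 ∧ j = 0 := by omega
      omega
  · rw [Finset.disjoint_left]
    intro y hy hy'
    simp only [Finset.mem_filter] at hy hy'
    omega

/-! ### The tournament after one step -/

/-- The set of tokens after one step. -/
def stepSet (s : Finset (Fin N)) (b : Fin N → Bool) : Finset (Fin N) :=
  keptTokens s b ∆ receivedTokens s b

/-- The process whose vertex in the tournament is copied to `p` in one step. -/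
def pull (b : Fin N → Bool) (p : Fin N) : Fin N :=
  if b ((finRotate N).symm p) = true then (finRotate N).symm p else p

theorem mem_stepSet {s : Finset (Fin N)} {b : Fin N → Bool} {p : Fin N} :
    p ∈ stepSet s b ↔ ((p ∈ s ∧ b p = false) ↔
      ¬ ((finRotate N).symm p ∈ s ∧ b ((finRotate N).symm p) = true)) := by
  have h : p ∈ receivedTokens s b ↔
      ((finRotate N).symm p ∈ s ∧ b ((finRotate N).symm p) = true) := by
    simp [receivedTokens, Finset.mem_map_equiv]
  rw [stepSet, Finset.mem_symmDiff, h, keptTokens, Finset.mem_filter]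
  tauto

/-- Modulo 2 annihilation is invisible, so only the flow across the two ends of the segment `[0, n)`
matters: from `last` into 0, and from the predecessor of `n` into `n`. -/
theorem cnt_stepSet (s : Finset (Fin N)) (b : Fin N → Bool) (last : Fin N)
    (hl : (last : ℕ) + 1 = N) (n : ℕ) (hn : n < N) :
    (cnt (stepSet s b) n + if last ∈ s ∧ b last = true then 1 else 0) % 2 =
    (cnt s n + if (finRotate N).symm ⟨n, hn⟩ ∈ s ∧ b ((finRotate N).symm ⟨n, hn⟩) = true
      then 1 else 0) % 2 := by
  induction n with
  | zero =>
    have : (finRotate N).symm ⟨0, hn⟩ = last := by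
      rw [Equiv.symm_apply_eq, Fin.ext_iff, val_finRotate, if_pos hl]
    simp only [cnt_zero, this]
  | succ n ih =>
    have h1 := ih (by omega)
    have h2 := cnt_succ (stepSet s b) ⟨n, by omega⟩
    have h3 := cnt_succ s ⟨n, by omega⟩
    have h4 : (finRotate N).symm ⟨n + 1, hn⟩ = ⟨n, by omega⟩ := by
      rw [Equiv.symm_apply_eq, Fin.ext_iff, val_finRotate]
      simp only
      rw [if_neg (by omega)]
    have h5 : (⟨n, by omega⟩ : Fin N) ∈ stepSet s b ↔ _ := mem_stepSet
    simp only at h2 h3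
    rw [h4]
    generalize (finRotate N).symm ⟨n, by omega⟩ = y at *
    generalize (⟨n, by omega⟩ : Fin N) = x at *
    generalize (if last ∈ s ∧ b last = true then 1 else 0) = w at *
    by_cases hx : x ∈ s <;> by_cases hbx : b x = true <;>
      by_cases hy : y ∈ s ∧ b y = true <;>
      simp only [hx, hbx, hy, if_true, if_false, true_and, false_and, not_true, not_false_eq_true,
        iff_true, iff_false, Bool.true_eq_false, Bool.not_eq_true] at * <;>
      simp only [h5, if_true, if_false, Bool.false_eq_true] at * <;> omega

/-- The extra 1 at `p = 0` is due to the wrap-around: there `pull b p` is the last process, whose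
count is compared with the odd total instead of 0. -/
theorem cnt_pull {s : Finset (Fin N)} (hs : Odd s.card) (b : Fin N → Bool) (p : Fin N) :
    (cnt s p + if (finRotate N).symm p ∈ s ∧ b ((finRotate N).symm p) = true then 1 else 0) % 2 =
    (cnt s (pull b p)
      + if (p : ℕ) = 0 ∧ b ((finRotate N).symm p) = true then 1 else 0) % 2 := by
  unfold pull
  obtain ⟨x, rfl⟩ := (finRotate N).surjective p
  rw [Equiv.symm_apply_apply]
  by_cases hb : b x = true
  · have h1 := val_finRotate x
    have h2 := cnt_succ s x
    have h3 := cnt_top s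
    have h4 := cnt_zero s
    rw [Nat.odd_iff] at hs
    simp only [hb, and_true, if_true]
    by_cases hx : (x : ℕ) + 1 = N
    · rw [if_pos hx] at h1
      rw [h1, h4, if_pos rfl]
      rw [hx] at h2
      omega
    · rw [if_neg hx] at h1
      rw [h1, if_neg (by omega : ¬ (x : ℕ) + 1 = 0)]
      omega
  · simp [hb]

theorem exists_last (p : Fin N) : ∃ last : Fin N, (last : ℕ) + 1 = N :=
  ⟨⟨N - 1, by have := p.2; omega⟩, by have := p.2; simp only; omega⟩

theorem val_pull (b : Fin N → Bool) (p : Fin N) :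
    (pull b p : ℕ) = if b ((finRotate N).symm p) = true then
      (if (p : ℕ) = 0 then N - 1 else (p : ℕ) - 1) else p := by
  unfold pull
  obtain ⟨x, rfl⟩ := (finRotate N).surjective p
  rw [Equiv.symm_apply_apply]
  have h1 := val_finRotate x
  have := x.2
  split_ifs at * <;> first | rfl | omega

/-- If the predecessor of `p` passes, its token (if any) crosses into the arc that starts at `p`;
starting the old arc one process earlier accounts for it. The same holds at `q`. -/
theorem rel_stepSet {s : Finset (Fin N)} (hs : Odd s.card) {b : Fin N → Bool} {p q : Fin N}
    (h : p ≠ q) (h' : pull b p ≠ pull b q) :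
    Rel (stepSet s b) p q ↔ Rel s (pull b p) (pull b q) := by
  obtain ⟨last, hl⟩ := exists_last p
  have hp := (cnt_stepSet s b last hl p p.2).trans (cnt_pull hs b p)
  have hq := (cnt_stepSet s b last hl q q.2).trans (cnt_pull hs b q)
  have vp := val_pull b p
  have vq := val_pull b q
  rw [rel_iff, rel_iff]
  rw [Ne, Fin.ext_iff] at h h'
  have p2 := p.2
  have q2 := q.2
  generalize (if last ∈ s ∧ b last = true then 1 else 0) = w at *
  generalize (pull b p) = p' at *
  generalize (pull b q) = q' at *
  generalize cnt (stepSet s b) p = c1 at *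
  generalize cnt (stepSet s b) q = c2 at *
  generalize cnt s p' = c3 at *
  generalize cnt s q' = c4 at *
  generalize b ((finRotate N).symm p) = b1 at *
  generalize b ((finRotate N).symm q) = b2 at *
  clear hs hl
  have e1 : ((p : ℕ) = 0 ∧ b1 = true ∧ (p' : ℕ) = N - 1 ∧ (c1 + w) % 2 = (c3 + 1) % 2) ∨
      (¬ ((p : ℕ) = 0 ∧ b1 = true) ∧ ((p' : ℕ) = p ∨ (p' : ℕ) + 1 = p) ∧
        (c1 + w) % 2 = c3 % 2) := by
    by_cases hb : b1 = true <;> by_cases h0 : (p : ℕ) = 0 <;>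
      simp only [hb, h0, if_true, if_false, and_true, true_and, and_false, false_and, not_true,
        not_false_eq_true, false_or, or_false, Bool.false_eq_true] at * <;> omega
  have e2 : ((q : ℕ) = 0 ∧ b2 = true ∧ (q' : ℕ) = N - 1 ∧ (c2 + w) % 2 = (c4 + 1) % 2) ∨
      (¬ ((q : ℕ) = 0 ∧ b2 = true) ∧ ((q' : ℕ) = q ∨ (q' : ℕ) + 1 = q) ∧
        (c2 + w) % 2 = c4 % 2) := by
    by_cases hb : b2 = true <;> by_cases h0 : (q : ℕ) = 0 <;>
      simp only [hb, h0, if_true, if_false, and_true, true_and, and_false, false_and, not_true,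
        not_false_eq_true, false_or, or_false, Bool.false_eq_true] at * <;> omega
  clear hp hq vp vq
  rcases e1 with ⟨h1, -, h2, h3⟩ | ⟨-, h1, h2⟩ <;> rcases e2 with ⟨g1, -, g2, g3⟩ | ⟨-, g1, g2⟩ <;>
    omega

theorem pull_eq_or (b : Fin N → Bool) (p : Fin N) : p = pull b p ∨ p = finRotate N (pull b p) := by
  unfold pull
  split_ifs
  · right; exact ((finRotate N).apply_symm_apply p).symm
  · left; rfl

/-- If `p` and `q` have the same image under `pull b`, every third vertex relates to both alike, so
no cyclic triangle contains them. For distinct images `rel_stepSet` applies to all three edges. -/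
theorem tri_stepSet {s : Finset (Fin N)} (hs : Odd s.card) {b : Fin N → Bool} {p q r : Fin N}
    (hpq : p ≠ q) (hqr : q ≠ r) (hrp : r ≠ p) :
    Tri (stepSet s b) p q r ↔ Tri s (pull b p) (pull b q) (pull b r) := by
  have key : ∀ p q r : Fin N, p ≠ q → q ≠ r → r ≠ p → pull b p = pull b q →
      Tri (stepSet s b) p q r → False := by
    intro p q r hpq hqr hrp h ht
    have hr : pull b r ≠ pull b p := by
      intro h'
      have h1 := pull_eq_or b p
      have h2 := pull_eq_or b q
      have h3 := pull_eq_or b r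
      rw [h'] at h3
      rw [← h] at h2
      generalize finRotate N (pull b p) = y at *
      generalize pull b p = x at *
      rcases h1 with rfl | rfl <;> rcases h2 with rfl | rfl <;> rcases h3 with rfl | rfl <;>
        contradiction
    have h1 := (rel_stepSet hs hrp hr).1 ht.2.2
    rw [h] at h1
    exact ht.2.1.asymm ((rel_stepSet hs hqr.symm (h ▸ hr)).2 h1)
  by_cases h1 : pull b p = pull b q
  · exact iff_of_false (key p q r hpq hqr hrp h1) (fun h => h.1.1 h1)
  by_cases h2 : pull b q = pull b r
  · exact iff_of_false (fun h => key q r p hqr hrp hpq h2 h.rotate) (fun h => h.2.1.1 h2)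
  by_cases h3 : pull b r = pull b p
  · exact iff_of_false (fun h => key r p q hrp hpq hqr h3 h.rotate.rotate) (fun h => h.2.2.1 h3)
  rw [Tri, Tri, rel_stepSet hs hpq h1, rel_stepSet hs hqr h2, rel_stepSet hs hrp h3]

/-! ### Cyclic tuples and coin patterns -/

/-- The numbers of vertices for which any two vertices of a cycle lie in a common triple of
consecutive vertices, and such triples have distinct vertices. -/
class Tight (m : ℕ) [NeZero m] : Prop where
  cover : ∀ i j : Fin m, i ≠ j → ∃ k : Fin m,
    (i = k ∨ i = k + 1 ∨ i = k + 2) ∧ (j = k ∨ j = k + 1 ∨ j = k + 2)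
  distinct : ∀ i : Fin m, i ≠ i + 1 ∧ i + 1 ≠ i + 2 ∧ i + 2 ≠ i

instance : Tight 3 := ⟨by decide, by decide⟩

instance : Tight 5 := ⟨by decide, by decide⟩

theorem Tri.ne {s : Finset (Fin N)} {p q r : Fin N} (h : Tri s p q r) : p ≠ q ∧ q ≠ r ∧ r ≠ p :=
  ⟨h.1.1, h.2.1.1, h.2.2.1⟩

theorem Cyc.injective {m : ℕ} [NeZero m] [Tight m] {s : Finset (Fin N)} {q : Fin m → Fin N}
    (h : Cyc s q) : Function.Injective q := by
  intro i j hij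
  by_contra hne
  obtain ⟨k, hi, hj⟩ := Tight.cover i j hne
  obtain ⟨h1, h2, h3⟩ := (h k).ne
  rcases hi with rfl | rfl | rfl <;> rcases hj with rfl | rfl | rfl <;>
    first
    | exact hne rfl
    | exact h1 hij
    | exact h2 hij
    | exact h3 hij
    | exact h1 hij.symm
    | exact h2 hij.symm
    | exact h3 hij.symm

theorem cyc_stepSet {m : ℕ} [NeZero m] [Tight m] {s : Finset (Fin N)} (hs : Odd s.card)
    {b : Fin N → Bool} {p : Fin m → Fin N} :
    Cyc (stepSet s b) p ↔ Function.Injective p ∧ Cyc s (fun i => pull b (p i)) := by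
  have key : Function.Injective p →
      (Cyc (stepSet s b) p ↔ Cyc s (fun i => pull b (p i))) := fun hp =>
    forall_congr' fun i => tri_stepSet hs (hp.ne (Tight.distinct i).1)
      (hp.ne (Tight.distinct i).2.1) (hp.ne (Tight.distinct i).2.2)
  exact ⟨fun h => ⟨h.injective, (key h.injective).1 h⟩, fun h => (key h.1).2 h.2⟩

/-- The coins at `m` distinct places are uniform on `Fin m → Bool`. The proof averages over the
shifts by xor with a pattern `c` placed at the range of `p`. -/
theorem sum_comp_injective {m : ℕ} {ι : Type*} [Fintype ι] {p : Fin m → ι}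
    (hp : Function.Injective p) (G : (Fin m → Bool) → ℝ) [DecidableEq ι] :
    2 ^ m * ∑ b : ι → Bool, G (fun i => b (p i)) = 2 ^ Fintype.card ι * ∑ c, G c := by
  have h1 : ∀ c : Fin m → Bool, ∑ b : ι → Bool, G (fun i => b (p i))
      = ∑ b : ι → Bool, G (fun i => xor (b (p i)) (c i)) := by
    intro c
    let e : (ι → Bool) ≃ (ι → Bool) := Function.Involutive.toPerm
      (fun b x => xor (b x) (Function.extend p c (fun _ => false) x))
      (fun b => by funext x; simp)
    rw [← Equiv.sum_comp e]
    refine Finset.sum_congr rfl fun b _ => congrArg G (funext fun i => ?_)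
    change xor (b (p i)) (Function.extend p c (fun _ => false) (p i)) = _
    rw [hp.extend_apply]
  have h2 : ∀ b : ι → Bool, ∑ c : Fin m → Bool, G (fun i => xor (b (p i)) (c i)) = ∑ c, G c := by
    intro b
    let e : (Fin m → Bool) ≃ (Fin m → Bool) := Function.Involutive.toPerm
      (fun c i => xor (b (p i)) (c i)) (fun b => by funext x; simp)
    exact Equiv.sum_comp e G
  have h3 : ∑ _c : Fin m → Bool, ∑ b : ι → Bool, G (fun i => b (p i))
      = ∑ _b : ι → Bool, ∑ c, G c := by
    rw [Finset.sum_congr rfl fun c _ => h1 c, Finset.sum_comm]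
    exact Finset.sum_congr rfl fun b _ => h2 b
  simpa using h3

theorem sum_rotate {m : ℕ} [NeZero m] {α : Type*} [Fintype α] (k : Fin m) (H : (Fin m → α) → ℝ) :
    ∑ q : Fin m → α, H (fun i => q (i + k)) = ∑ q, H q := by
  classical
  exact Equiv.sum_comp ((Equiv.addRight k).symm.arrowCongr (Equiv.refl α)) H

theorem Cyc.rotate {m : ℕ} [NeZero m] {s : Finset (Fin N)} {q : Fin m → Fin N} (h : Cyc s q)
    (k : Fin m) : Cyc s (fun i => q (i + k)) := fun i => by
  have := h (i + k)
  rwa [add_right_comm i k 1, add_right_comm i k 2] at this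

theorem cyc_rotate {m : ℕ} [NeZero m] {s : Finset (Fin N)} {q : Fin m → Fin N} (k : Fin m) :
    Cyc s (fun i => q (i + k)) ↔ Cyc s q :=
  ⟨fun h => by simpa using h.rotate (-k), fun h => h.rotate k⟩

theorem sum_coin_pattern {m : ℕ} [NeZero m] [Tight m] (i : Fin m) :
    ∑ c : Fin m → Bool, (if c i = true ∧ c (i + 1) = false then (1 : ℝ) else 0) = 2 ^ m / 4 := by
  have hp : Function.Injective ![i, i + 1] := by
    have := (Tight.distinct i).1
    intro a b
    fin_cases a <;> fin_cases b <;> simp [this, this.symm]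
  have h := sum_comp_injective hp (fun c => if c 0 = true ∧ c 1 = false then (1 : ℝ) else 0)
  have h' : ∑ c : Fin 2 → Bool, (if c 0 = true ∧ c 1 = false then (1 : ℝ) else 0) = 1 := by
    rw [Finset.sum_boole]
    have : (Finset.univ.filter fun c : Fin 2 → Bool => c 0 = true ∧ c 1 = false)
        = {![true, false]} := by
      ext c
      simp only [Finset.mem_filter, Finset.mem_univ, true_and, Finset.mem_singleton]
      constructor
      · rintro ⟨h0, h1⟩
        funext j
        fin_cases j <;> simp [h0, h1]
      · rintro rfl
        simp
    rw [this]
    simp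
  rw [h', Fintype.card_fin] at h
  replace h : 2 ^ 2 * ∑ c : Fin m → Bool, (if c i = true ∧ c (i + 1) = false then (1 : ℝ) else 0)
    = 2 ^ m * 1 := h
  linarith

theorem fin_five_add (i j : Fin 5) : i + 1 + 1 = i + 2 ∧ i + 1 + 2 = i + 3 ∧ i + 2 + 1 = i + 3 ∧
    i + 2 + 2 = i + 4 ∧ i + 3 + 2 = i ∧ i + 3 + 1 = i + 4 ∧ i + 1 ≠ i ∧ i + 1 ≠ i + 2 ∧
    i + 1 ≠ i + 3 ∧ i + 2 ≠ i ∧ i + 2 ≠ i + 4 ∧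
    (j = i ∨ j = i + 1 ∨ j = i + 2 ∨ j = i + 3 ∨ j = i + 4) := by
  revert i j; decide

/-- Each entry beats those 1 and 3 places further. By `rel_finRotate_right`, every other entry
distinguishes `q i` from its neighbour `q j` exactly if `q i` holds a token, that is, if `q i → q
j`. For `j = i + 2`, `i + 3`, `i + 4` the entry `i + 1`, `i + 1`, `i + 2`, respectively, violates
this. -/
theorem Cyc.eq_add_one {s : Finset (Fin N)} (hN : 2 ≤ N) (hs : Odd s.card) {q : Fin 5 → Fin N}
    (h : Cyc s q) {i j : Fin 5} (hij : i ≠ j) (hq : q j = finRotate N (q i)) : j = i + 1 := by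
  obtain ⟨a1, a2, a3, a4, a5, a6, n1, n2, n3, n4, n5, hj⟩ := fin_five_add i j
  have h0 := h i
  have h1 := h (i + 1)
  have h2 := h (i + 2)
  have h3 := h (i + 3)
  rw [a1, a2] at h1
  rw [a3, a4] at h2
  rw [a5, a6] at h3
  have hx := rel_finRotate hN hs (q i)
  have hw : ∀ k, k ≠ i → k ≠ j → (Rel s (q k) (q j) ↔ (Rel s (q k) (q i) ↔ q i ∉ s)) := by
    intro k hki hkj
    rw [hq]
    exact rel_finRotate_right hs (h.injective.ne hki) (hq ▸ h.injective.ne hkj)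
  rw [← hq] at hx
  rcases hj with rfl | rfl | rfl | rfl | rfl
  · exact absurd rfl hij
  · rfl
  · have := hw (i + 1) n1 n2
    have b1 := h0.1.asymm
    have b2 := h0.2.1
    have b3 := h0.2.2.asymm
    tauto
  · have := hw (i + 1) n1 n3
    have b1 := h0.1.asymm
    have b2 := h1.2.2.asymm
    have b3 := h3.2.2.asymm
    have b4 := h3.1
    have b5 := h3.2.1.asymm
    have b6 : Rel s (q i) (q (i + 3)) := h3.2.2
    tauto
  · have := hw (i + 2) n4 n5
    have b1 := h0.2.2
    have b2 := h2.2.2.asymm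
    have b3 := h3.2.1.asymm
    tauto

/-! ### Expected numbers of cyclic tuples after one step -/

section Counting

open scoped Classical

/-- The number of cyclic tuples of length `m`. -/
noncomputable def cycCount (m : ℕ) [NeZero m] (s : Finset (Fin N)) : ℝ :=
  ∑ q : Fin m → Fin N, if Cyc s q then 1 else 0

/-- The number of cyclic tuples of length `m` whose first two entries are neighbours. -/
noncomputable def adjCount (m : ℕ) [NeZero m] (s : Finset (Fin N)) : ℝ :=
  ∑ q : Fin m → Fin N, if Cyc s q ∧ q 1 = finRotate N (q 0) then 1 else 0

/-- The tuple `q` after each entry with `c i = true` has moved to its clockwise neighbour. -/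
def push {m : ℕ} (c : Fin m → Bool) (q : Fin m → Fin N) (i : Fin m) : Fin N :=
  if c i = true then finRotate N (q i) else q i

/-- Substituting `p = push c q` turns the sum over new tuples with cyclic pullback into a sum over
old cyclic tuples `q`, each weighted by the number of coin patterns that keep its entries distinct.
-/
theorem sum_cycCount_stepSet {m : ℕ} [NeZero m] [Tight m] {s : Finset (Fin N)}
    (hs : Odd s.card) :
    2 ^ m * ∑ b : Fin N → Bool, cycCount m (stepSet s b) = 2 ^ N * ∑ q : Fin m → Fin N,
      if Cyc s q then ∑ c : Fin m → Bool, (if Function.Injective (push c q) then (1 : ℝ) else 0)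
      else 0 := by
  have h1 : ∀ p : Fin m → Fin N,
      2 ^ m * ∑ b : Fin N → Bool, (if Cyc (stepSet s b) p then (1 : ℝ) else 0)
      = 2 ^ N * ∑ c : Fin m → Bool, if Function.Injective p ∧
        Cyc s (fun i => if c i = true then (finRotate N).symm (p i) else p i)
        then (1 : ℝ) else 0 := by
    intro p
    simp_rw [cyc_stepSet hs]
    by_cases hp : Function.Injective p
    · simp only [hp, true_and]
      have := sum_comp_injective ((finRotate N).symm.injective.comp hp) (fun c =>
        if Cyc s (fun i => if c i = true then (finRotate N).symm (p i) else p i)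
        then (1 : ℝ) else 0)
      rw [Fintype.card_fin] at this
      exact this
    · simp [hp]
  unfold cycCount
  rw [Finset.sum_comm, Finset.mul_sum, Finset.sum_congr rfl fun p _ => h1 p, ← Finset.mul_sum,
    Finset.sum_comm]
  have h2 : ∀ q : Fin m → Fin N,
      (if Cyc s q then ∑ c : Fin m → Bool, (if Function.Injective (push c q) then (1 : ℝ) else 0)
      else 0) = ∑ c : Fin m → Bool,
        if Function.Injective (push c q) ∧ Cyc s q then (1 : ℝ) else 0 := by
    intro q
    split_ifs with h <;> simp [h]
  rw [Finset.sum_congr rfl fun q _ => h2 q,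
    Finset.sum_comm (s := (Finset.univ : Finset (Fin m → Fin N)))]
  congr 1
  refine Finset.sum_congr rfl fun c _ => ?_
  let e : (Fin m → Fin N) ≃ (Fin m → Fin N) :=
    Equiv.piCongrRight (fun i => if c i = true then finRotate N else Equiv.refl _)
  have he : ∀ q, e q = push c q := by
    intro q
    funext i
    change (if c i = true then finRotate N else Equiv.refl _) (q i) = _
    unfold push
    split_ifs <;> rfl
  rw [← Equiv.sum_comp e]
  refine Finset.sum_congr rfl fun q _ => ?_
  rw [he]
  have : (fun i => if c i = true then (finRotate N).symm (push c q i) else push c q i) = q := by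
    funext i
    unfold push
    split_ifs
    · exact Equiv.symm_apply_apply _ _
    · rfl
  rw [this]

theorem sum_cyc_adj {m : ℕ} [NeZero m] (s : Finset (Fin N)) :
    ∑ q : Fin m → Fin N, (if Cyc s q then
      ∑ i : Fin m, (if q (i + 1) = finRotate N (q i) then (1 : ℝ) else 0) else 0)
    = m * adjCount m s := by
  have h1 : ∀ i : Fin m, ∑ q : Fin m → Fin N,
      (if Cyc s q ∧ q (i + 1) = finRotate N (q i) then (1 : ℝ) else 0) = adjCount m s := by
    intro i
    have := sum_rotate i (fun q : Fin m → Fin N =>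
      if Cyc s q ∧ q 1 = finRotate N (q 0) then (1 : ℝ) else 0)
    simp only [cyc_rotate, zero_add, add_comm 1 i] at this
    exact this
  have h2 : ∀ q : Fin m → Fin N, (if Cyc s q then
      ∑ i : Fin m, (if q (i + 1) = finRotate N (q i) then (1 : ℝ) else 0) else 0)
      = ∑ i : Fin m, (if Cyc s q ∧ q (i + 1) = finRotate N (q i) then (1 : ℝ) else 0) := by
    intro q
    split_ifs with h <;> simp [h]
  rw [Finset.sum_congr rfl fun q _ => h2 q, Finset.sum_comm, Finset.sum_congr rfl fun i _ => h1 i]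
  simp

theorem not_injective_push {m : ℕ} [NeZero m] [Tight m] {q : Fin m → Fin N} {c : Fin m → Bool}
    {i : Fin m} (h : q (i + 1) = finRotate N (q i)) (h1 : c i = true) (h2 : c (i + 1) = false) :
    ¬ Function.Injective (push c q) := fun hi =>
  (Tight.distinct i).1 (hi (by simp [push, h, h1, h2]))

/-- An upper bound only needs some of the collisions: those between cyclically consecutive entries,
which are mutually exclusive and use 2 of the 8 patterns each. -/
theorem sum_injective_push_three (q : Fin 3 → Fin N) :
    ∑ c : Fin 3 → Bool, (if Function.Injective (push c q) then (1 : ℝ) else 0)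
      ≤ 8 - 2 * ∑ i : Fin 3, (if q (i + 1) = finRotate N (q i) then (1 : ℝ) else 0) := by
  have h1 : ∀ c : Fin 3 → Bool, (if Function.Injective (push c q) then (1 : ℝ) else 0)
      ≤ 1 - ∑ i : Fin 3, (if q (i + 1) = finRotate N (q i) then (1 : ℝ) else 0) *
        (if c i = true ∧ c (i + 1) = false then (1 : ℝ) else 0) := by
    intro c
    split_ifs with h
    · rw [Finset.sum_eq_zero, sub_zero]
      intro i _
      split_ifs with h1 h2
      · exact absurd h (not_injective_push h1 h2.1 h2.2)
      all_goals simp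
    · rw [sub_nonneg]
      calc _ ≤ ∑ i : Fin 3, (if c i = true ∧ c (i + 1) = false then (1 : ℝ) else 0) := by
            refine Finset.sum_le_sum fun i _ => ?_
            split_ifs <;> norm_num
        -- A cyclic binary word of length 3 has at most one descent from `true` to `false`.
        _ ≤ 1 := by
            rw [Fin.sum_univ_three]
            have e1 : (0 : Fin 3) + 1 = 1 := rfl
            have e2 : (1 : Fin 3) + 1 = 2 := rfl
            have e3 : (2 : Fin 3) + 1 = 0 := rfl
            rw [e1, e2, e3]
            cases c 0 <;> cases c 1 <;> cases c 2 <;> simp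
  refine (Finset.sum_le_sum fun c _ => h1 c).trans (le_of_eq ?_)
  rw [Finset.sum_sub_distrib, Finset.sum_comm]
  simp_rw [← Finset.mul_sum, sum_coin_pattern]
  rw [← Finset.sum_mul]
  simp
  ring

/-- A union bound, with 8 of the 32 patterns for each neighbouring pair. It covers all collisions
since neighbours in a cyclic 5-tuple are consecutive entries (`Cyc.eq_add_one`). -/
theorem sum_injective_push_five {s : Finset (Fin N)} (hN : 2 ≤ N) (hs : Odd s.card)
    {q : Fin 5 → Fin N} (hq : Cyc s q) :
    32 - 8 * ∑ i : Fin 5, (if q (i + 1) = finRotate N (q i) then (1 : ℝ) else 0)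
      ≤ ∑ c : Fin 5 → Bool, (if Function.Injective (push c q) then (1 : ℝ) else 0) := by
  have h1 : ∀ c : Fin 5 → Bool,
      1 - ∑ i : Fin 5, (if q (i + 1) = finRotate N (q i) then (1 : ℝ) else 0) *
        (if c i = true ∧ c (i + 1) = false then (1 : ℝ) else 0)
      ≤ (if Function.Injective (push c q) then (1 : ℝ) else 0) := by
    intro c
    have hnn : ∀ i ∈ Finset.univ, 0 ≤ (if q (i + 1) = finRotate N (q i) then (1 : ℝ) else 0) *
        (if c i = true ∧ c (i + 1) = false then (1 : ℝ) else 0) := by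
      intro i _
      split_ifs <;> norm_num
    split_ifs with h
    · exact sub_le_self _ (Finset.sum_nonneg hnn)
    · rw [sub_nonpos]
      have key : ∃ i, q (i + 1) = finRotate N (q i) ∧ c i = true ∧ c (i + 1) = false := by
        simp only [Function.Injective, not_forall] at h
        obtain ⟨i, j, hij, hne⟩ := h
        unfold push at hij
        cases hi : c i <;> cases hj : c j <;>
          simp only [hi, hj, if_true, Bool.false_eq_true, if_false, EmbeddingLike.apply_eq_iff_eq,
            hq.injective.eq_iff] at hij
        · exact absurd hij hne
        · have := hq.eq_add_one hN hs (Ne.symm hne) hij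
          subst this
          exact ⟨j, hij, hj, hi⟩
        · have := hq.eq_add_one hN hs hne hij.symm
          subst this
          exact ⟨i, hij.symm, hi, hj⟩
        · exact absurd hij hne
      obtain ⟨i, hi⟩ := key
      refine le_trans (le_of_eq ?_) (Finset.single_le_sum hnn (Finset.mem_univ i))
      rw [if_pos hi.1, if_pos hi.2, one_mul]
  refine le_trans (le_of_eq ?_) (Finset.sum_le_sum fun c _ => h1 c)
  rw [Finset.sum_sub_distrib, Finset.sum_comm (s := (Finset.univ : Finset (Fin 5 → Bool)))]
  simp_rw [← Finset.mul_sum, sum_coin_pattern]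
  rw [← Finset.sum_mul]
  simp
  ring

theorem sum_cycCount_three_stepSet_le {s : Finset (Fin N)} (hs : Odd s.card) :
    ∑ b : Fin N → Bool, cycCount 3 (stepSet s b)
      ≤ 2 ^ N * (cycCount 3 s - 3 / 4 * adjCount 3 s) := by
  have h := sum_cycCount_stepSet (m := 3) hs
  have h' : ∑ q : Fin 3 → Fin N, (if Cyc s q then
      ∑ c : Fin 3 → Bool, (if Function.Injective (push c q) then (1 : ℝ) else 0) else 0)
      ≤ 8 * cycCount 3 s - 2 * (3 * adjCount 3 s) := by
    have := sum_cyc_adj (m := 3) s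
    push_cast at this
    rw [← this, cycCount, Finset.mul_sum, Finset.mul_sum, ← Finset.sum_sub_distrib]
    refine Finset.sum_le_sum fun q _ => ?_
    have := sum_injective_push_three q
    split_ifs
    · linarith
    · simp
  have := mul_le_mul_of_nonneg_left h' (by positivity : (0 : ℝ) ≤ 2 ^ N)
  linarith

theorem le_sum_cycCount_five_stepSet {s : Finset (Fin N)} (hN : 2 ≤ N) (hs : Odd s.card) :
    2 ^ N * (cycCount 5 s - 5 / 4 * adjCount 5 s)
      ≤ ∑ b : Fin N → Bool, cycCount 5 (stepSet s b) := by
  have h := sum_cycCount_stepSet (m := 5) hs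
  have h' : 32 * cycCount 5 s - 8 * (5 * adjCount 5 s) ≤
      ∑ q : Fin 5 → Fin N, (if Cyc s q then
      ∑ c : Fin 5 → Bool, (if Function.Injective (push c q) then (1 : ℝ) else 0) else 0) := by
    have := sum_cyc_adj (m := 5) s
    push_cast at this
    rw [← this, cycCount, Finset.mul_sum, Finset.mul_sum, ← Finset.sum_sub_distrib]
    refine Finset.sum_le_sum fun q _ => ?_
    split_ifs with hq
    · have := sum_injective_push_five hN hs hq
      linarith
    · simp
  have := mul_le_mul_of_nonneg_left h' (by positivity : (0 : ℝ) ≤ 2 ^ N)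
  linarith

end Counting

/-! ### Bounds for the numbers of cyclic tuples -/

theorem sum_fin_succ_fun {n : ℕ} {α : Type*} [Fintype α] (G : (Fin (n + 1) → α) → ℝ) :
    ∑ q, G q = ∑ a : α, ∑ q : Fin n → α, G (Matrix.vecCons a q) := by
  rw [← Fintype.sum_prod_type']
  exact (Equiv.sum_comp (Fin.consEquiv (fun _ => α)) G).symm

theorem sum_fin_three_fun {α : Type*} [Fintype α] (G : (Fin 3 → α) → ℝ) :
    ∑ q, G q = ∑ a : α, ∑ b : α, ∑ c : α, G ![a, b, c] := by
  simp only [sum_fin_succ_fun (α := α), Finset.univ_unique, Finset.sum_singleton]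
  rfl

theorem sum_fin_five_fun {α : Type*} [Fintype α] (G : (Fin 5 → α) → ℝ) :
    ∑ q, G q = ∑ a : α, ∑ b : α, ∑ c : α, ∑ d : α, ∑ e : α, G ![a, b, c, d, e] := by
  simp only [sum_fin_succ_fun (α := α), Finset.univ_unique, Finset.sum_singleton]
  rfl

theorem cyc_three {s : Finset (Fin N)} {q : Fin 3 → Fin N} :
    Cyc s q ↔ Tri s (q 0) (q 1) (q 2) := by
  refine ⟨fun h => h 0, fun h i => ?_⟩
  fin_cases i
  · exact h
  · exact h.rotate
  · exact h.rotate.rotate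

theorem tri_finRotate {s : Finset (Fin N)} (hN : 2 ≤ N) (hs : Odd s.card) {x r : Fin N}
    (hx : x ∈ s) (h : Rel s r x) : Tri s x (finRotate N x) r := by
  have h1 := (rel_finRotate hN hs x).2 hx
  have h2 : r ≠ finRotate N x := by
    rintro rfl
    exact h1.asymm h
  have h3 := rel_finRotate_right hs h.1 h2
  refine ⟨h1, ?_, h⟩
  rw [rel_comm h2]
  tauto

section Counting

open scoped Classical

theorem cycCount_nonneg (m : ℕ) [NeZero m] (s : Finset (Fin N)) : 0 ≤ cycCount m s :=
  Finset.sum_nonneg fun q _ => by split_ifs <;> norm_num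

theorem sum_rel_tokens {s : Finset (Fin N)} (hs : Odd s.card) (r : Fin N) :
    ∑ x ∈ s, (if Rel s r x then (1 : ℝ) else 0) = ((s.card : ℝ) - 1) / 2 := by
  rw [Finset.sum_boole, card_rel_tokens hs]
  obtain ⟨k, hk⟩ := hs
  rw [hk, Nat.add_sub_cancel, Nat.mul_div_cancel_left k two_pos]
  push_cast
  ring

/-- Each process `r` beats `(K-1)/2` tokens `x`, and each such pair yields the triangle of `x`, its
clockwise neighbour and `r`. -/
theorem le_adjCount_three {s : Finset (Fin N)} (hN : 2 ≤ N) (hs : Odd s.card) :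
    (N : ℝ) * (((s.card : ℝ) - 1) / 2) ≤ adjCount 3 s := by
  have h1 : (N : ℝ) * (((s.card : ℝ) - 1) / 2)
      = ((Finset.univ ×ˢ s).filter (fun z : Fin N × Fin N => Rel s z.1 z.2)).card := by
    rw [← Finset.sum_boole, Finset.sum_product]
    simp only [sum_rel_tokens hs]
    simp
  rw [h1, adjCount, Finset.sum_boole, Nat.cast_le]
  refine Finset.card_le_card_of_injOn (fun z => ![z.2, finRotate N z.2, z.1]) ?_ ?_
  · rintro ⟨r, x⟩ hz
    simp only [Finset.coe_filter, Finset.mem_product, Finset.mem_univ, true_and,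
      Set.mem_ofPred_eq] at hz ⊢
    exact ⟨cyc_three.2 (tri_finRotate hN hs hz.1 hz.2), rfl⟩
  · rintro ⟨r, x⟩ _ ⟨r', x'⟩ _ h
    have h0 := congrFun h 0
    have h2 := congrFun h 2
    simp only [Matrix.cons_val] at h0 h2
    rw [h0, h2]

/-- A tuple counted on the left is determined by the token `q 0` and the triangle `(q 2, q 3, q 4)`,
in which `q 2` and `q 4` beat `q 0` but `q 3` does not. So it suffices to count tokens beaten by two
vertices of a given triangle. -/
theorem adjCount_five_le {s : Finset (Fin N)} (hN : 2 ≤ N) (hs : Odd s.card) :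
    adjCount 5 s ≤ ((s.card : ℝ) - 3) / 6 * cycCount 3 s := by
  let D : Fin 3 → ℝ := fun k => ∑ r : Fin 3 → Fin N, if Cyc s r then ∑ x ∈ s,
    (if Rel s (r (0 + k)) x ∧ ¬ Rel s (r (1 + k)) x ∧ Rel s (r (2 + k)) x then (1 : ℝ) else 0)
    else 0
  have hD : ∀ k, D k = D 0 := by
    intro k
    have := sum_rotate k (fun r : Fin 3 → Fin N => if Cyc s r then ∑ x ∈ s,
      (if Rel s (r 0) x ∧ ¬ Rel s (r 1) x ∧ Rel s (r 2) x then (1 : ℝ) else 0) else 0)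
    simp only [cyc_rotate] at this
    simpa only [D, add_zero] using this
  have hsum : D 0 + D 1 + D 2 = ((s.card : ℝ) - 3) / 2 * cycCount 3 s := by
    simp only [D]
    rw [← Finset.sum_add_distrib, ← Finset.sum_add_distrib, cycCount, Finset.mul_sum]
    refine Finset.sum_congr rfl fun r _ => ?_
    split_ifs with hr
    · rw [← Finset.sum_add_distrib, ← Finset.sum_add_distrib, mul_one]
      -- One or two vertices of the triangle beat `x`, so "two do" is their number minus 1. Over all
      -- tokens this sums to `3(K-1)/2 - K = (K-3)/2`.
      refine (Finset.sum_congr rfl (g := fun x => ((if Rel s (r 0) x then (1 : ℝ) else 0)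
          + (if Rel s (r 1) x then (1 : ℝ) else 0) + (if Rel s (r 2) x then (1 : ℝ) else 0)) - 1)
          fun x _ => ?_).trans ?_
      · obtain ⟨h1, h2⟩ := (cyc_three.1 hr).one_or_two x
        have e1 : (0 : Fin 3) + 1 = 1 := rfl
        have e2 : (1 : Fin 3) + 1 = 2 := rfl
        have e3 : (2 : Fin 3) + 1 = 0 := rfl
        have e4 : (0 : Fin 3) + 2 = 2 := rfl
        have e5 : (1 : Fin 3) + 2 = 0 := rfl
        have e6 : (2 : Fin 3) + 2 = 1 := rfl
        rw [e1, e2, e3, e4, e5, e6, add_zero, add_zero, add_zero]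
        by_cases a0 : Rel s (r 0) x <;> by_cases a1 : Rel s (r 1) x <;>
          by_cases a2 : Rel s (r 2) x <;> simp only [a0, a1, a2] at h1 h2 ⊢ <;> norm_num at *
      · rw [Finset.sum_sub_distrib, Finset.sum_add_distrib,
          Finset.sum_add_distrib, sum_rel_tokens hs, sum_rel_tokens hs, sum_rel_tokens hs]
        simp
        ring
    · simp
  have hle : adjCount 5 s ≤ D 0 := by
    have : D 0 = ((Finset.univ ×ˢ s).filter (fun z : (Fin 3 → Fin N) × Fin N => Cyc s z.1 ∧
        Rel s (z.1 0) z.2 ∧ ¬ Rel s (z.1 1) z.2 ∧ Rel s (z.1 2) z.2)).card := by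
      rw [← Finset.sum_boole, Finset.sum_product]
      refine Finset.sum_congr rfl fun r _ => ?_
      by_cases hr : Cyc s r <;> simp [hr]
    rw [this, adjCount, Finset.sum_boole, Nat.cast_le]
    refine Finset.card_le_card_of_injOn (fun q => (![q 2, q 3, q 4], q 0)) ?_ ?_
    · intro q hq
      simp only [Finset.coe_filter, Finset.mem_product, Finset.mem_univ, true_and,
        Set.mem_ofPred_eq] at hq ⊢
      obtain ⟨hc, h1⟩ := hq
      have hx : q 0 ∈ s := (rel_finRotate hN hs (q 0)).1 (h1 ▸ (hc 0).1)
      exact ⟨hx, cyc_three.2 (hc 2), (hc 0).2.2, Rel.asymm (hc 3).2.2, (hc 4).1⟩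
    · intro q hq q' hq' h
      simp only [Finset.coe_filter, Finset.mem_univ, true_and, Set.mem_ofPred_eq] at hq hq'
      have h0 := congrArg Prod.snd h
      have h' := congrArg Prod.fst h
      have h2 := congrFun h' 0
      have h3 := congrFun h' 1
      have h4 := congrFun h' 2
      simp only [Matrix.cons_val] at h0 h2 h3 h4
      funext i
      fin_cases i
      · exact h0
      · exact hq.2.trans (h0 ▸ hq'.2.symm)
      · exact h2
      · exact h3
      · exact h4
  rw [hD 1, hD 2] at hsum
  linarith

/-- With `B` the skew ±1 matrix of the tournament, the product `T` is 8 on cyclic triangles and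
never negative. Adding the reversed orientation cancels the odd terms, and the quadratic ones sum to
minus a sum of squares of the row sums of `B`. -/
theorem cycCount_three_le (s : Finset (Fin N)) : cycCount 3 s ≤ (N : ℝ) ^ 3 / 8 := by
  let B : Fin N → Fin N → ℝ := fun p q => if Rel s p q then 1 else if p = q then 0 else -1
  have hB : ∀ p q, B q p = - B p q := by
    intro p q
    by_cases h : p = q
    · subst h; simp [B, not_rel_self]
    · have := rel_comm (s := s) h
      by_cases h' : Rel s p q
      · simp [B, this, h', Ne.symm h]
      · simp [B, this, h', h]
  have hB1 : ∀ p q, -1 ≤ B p q := by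
    intro p q
    simp only [B]
    split_ifs <;> norm_num
  have hneg : ∑ a, ∑ b, ∑ c, B a b * B b c ≤ 0 := by
    rw [Finset.sum_comm]
    refine Finset.sum_nonpos fun b _ => ?_
    have : ∑ a, ∑ c, B a b * B b c = -(∑ c, B b c) ^ 2 := by
      rw [← Finset.sum_mul_sum, Finset.sum_congr rfl fun a _ => hB b a, Finset.sum_neg_distrib]
      ring
    rw [this]
    exact neg_nonpos.2 (sq_nonneg _)
  have hneg2 : ∑ a, ∑ b, ∑ c, B b c * B c a ≤ 0 := by
    refine le_trans (le_of_eq ?_) hneg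
    rw [Finset.sum_comm]
    exact Finset.sum_congr rfl fun b _ => Finset.sum_comm
  have hneg3 : ∑ a, ∑ b, ∑ c, B c a * B a b ≤ 0 := by
    refine le_trans (le_of_eq ?_) hneg2
    rw [Finset.sum_comm]
    exact Finset.sum_congr rfl fun b _ => Finset.sum_comm
  let T : Fin N → Fin N → Fin N → ℝ := fun p q r => (1 + B p q) * (1 + B q r) * (1 + B r p)
  have h1 : 8 * cycCount 3 s ≤ ∑ p, ∑ q, ∑ r, T p q r := by
    rw [cycCount, sum_fin_three_fun, Finset.mul_sum]
    refine Finset.sum_le_sum fun p _ => ?_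
    rw [Finset.mul_sum]
    refine Finset.sum_le_sum fun q _ => ?_
    rw [Finset.mul_sum]
    refine Finset.sum_le_sum fun r _ => ?_
    split_ifs with h
    · have h' : Tri s p q r := cyc_three.1 h
      simp only [T, B, if_pos h'.1, if_pos h'.2.1, if_pos h'.2.2]
      norm_num
    · have a1 := hB1 p q
      have a2 := hB1 q r
      have a3 := hB1 r p
      rw [mul_zero]
      exact mul_nonneg (mul_nonneg (by linarith) (by linarith)) (by linarith)
  have h2 : ∑ p, ∑ q, ∑ r, T p q r = ∑ p, ∑ q, ∑ r, T r q p := by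
    rw [Finset.sum_comm, Finset.sum_congr rfl fun q _ => Finset.sum_comm, Finset.sum_comm]
  have h3 : ∑ p, ∑ q, ∑ r, T p q r + ∑ p, ∑ q, ∑ r, T r q p = 2 * ((N : ℝ) ^ 3 +
      (∑ a, ∑ b, ∑ c, B a b * B b c + ∑ a, ∑ b, ∑ c, B b c * B c a
        + ∑ a, ∑ b, ∑ c, B c a * B a b)) := by
    have : (N : ℝ) ^ 3 = ∑ _a : Fin N, ∑ _b : Fin N, ∑ _c : Fin N, (1 : ℝ) := by
      simp; ring
    rw [this]
    simp only [← Finset.sum_add_distrib, Finset.mul_sum]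
    refine Finset.sum_congr rfl fun p _ => Finset.sum_congr rfl fun q _ =>
      Finset.sum_congr rfl fun r _ => ?_
    simp only [T]
    rw [hB p q, hB q r, hB r p]
    ring
  linarith

/-- Fix `p, u` and let `P` count the `x` that close a cyclic triangle with them. In a cyclic tuple
`(p, u, x, v, y)` both `x` and `y` are of this kind and `v` is not, as `p → v`. Since `x → v → y`,
each `v` admits at most `P²/4` pairs, and `(N - P) P²/4 ≤ N² P / 16`. -/
theorem cycCount_five_le (s : Finset (Fin N)) :
    cycCount 5 s ≤ (N : ℝ) ^ 2 / 16 * cycCount 3 s := by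
  rw [cycCount, cycCount, sum_fin_five_fun, sum_fin_three_fun, Finset.mul_sum]
  refine Finset.sum_le_sum fun p _ => ?_
  rw [Finset.mul_sum]
  refine Finset.sum_le_sum fun u _ => ?_
  let t : Fin N → ℝ := fun x => if Tri s p u x then 1 else 0
  let ρ : Fin N → Fin N → ℝ := fun x y => if Rel s x y then 1 else 0
  have ht : ∀ x, 0 ≤ t x := fun x => by simp only [t]; split_ifs <;> norm_num
  have hρ : ∀ x y, 0 ≤ ρ x y := fun x y => by simp only [ρ]; split_ifs <;> norm_num
  have hρ1 : ∀ x y, ρ x y + ρ y x ≤ 1 := by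
    intro x y
    simp only [ρ]
    by_cases h : Rel s x y
    · simp [h, h.asymm]
    · simp only [h, if_false, zero_add]
      split_ifs <;> norm_num
  have h1 : ∀ x v y, (if Cyc s ![p, u, x, v, y] then (1 : ℝ) else 0)
      ≤ (1 - t v) * ((t x * ρ x v) * (t y * ρ v y)) := by
    intro x v y
    have hv : 0 ≤ 1 - t v := by simp only [t]; split_ifs <;> norm_num
    split_ifs with h
    · have a1 : Tri s p u x := h 0
      have a2 : Tri s x v y := h 2
      have a3 : Tri s y p u := h 4
      have a4 : Rel s p v := (h 3).2.2
      have a5 : ¬ Tri s p u v := fun h' => a4.asymm h'.2.2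
      simp [t, ρ, a1, a2.1, a2.2.1, a3.rotate, a5]
    · exact mul_nonneg hv (mul_nonneg (mul_nonneg (ht x) (hρ x v)) (mul_nonneg (ht y) (hρ v y)))
  set P := ∑ x, t x with hP
  have h2 : ∀ v, (∑ x, t x * ρ x v) * (∑ y, t y * ρ v y) ≤ P ^ 2 / 4 := by
    intro v
    have a : ∑ x, t x * ρ x v + ∑ y, t y * ρ v y ≤ P := by
      rw [hP, ← Finset.sum_add_distrib]
      refine Finset.sum_le_sum fun x _ => ?_
      have := mul_le_mul_of_nonneg_left (hρ1 x v) (ht x)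
      linarith
    have b1 : 0 ≤ ∑ x, t x * ρ x v := Finset.sum_nonneg fun x _ => mul_nonneg (ht x) (hρ x v)
    have b2 : 0 ≤ ∑ x, t x * ρ v x := Finset.sum_nonneg fun x _ => mul_nonneg (ht x) (hρ v x)
    nlinarith [sq_nonneg (∑ x, t x * ρ x v - ∑ y, t y * ρ v y)]
  have hP0 : 0 ≤ P := Finset.sum_nonneg fun x _ => ht x
  calc _ ≤ ∑ x, ∑ v, ∑ y, (1 - t v) * ((t x * ρ x v) * (t y * ρ v y)) :=
        Finset.sum_le_sum fun x _ => Finset.sum_le_sum fun v _ => Finset.sum_le_sum fun y _ =>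
          h1 x v y
    _ = ∑ v, (1 - t v) * ((∑ x, t x * ρ x v) * (∑ y, t y * ρ v y)) := by
        rw [Finset.sum_comm]
        refine Finset.sum_congr rfl fun v _ => ?_
        rw [Finset.sum_mul_sum, Finset.mul_sum]
        exact Finset.sum_congr rfl fun x _ => (Finset.mul_sum _ _ _).symm
    _ ≤ ∑ v, (1 - t v) * (P ^ 2 / 4) := by
        refine Finset.sum_le_sum fun v _ => mul_le_mul_of_nonneg_left (h2 v) ?_
        simp only [t]; split_ifs <;> norm_num
    _ = (N - P) * (P ^ 2 / 4) := by
        rw [← Finset.sum_mul, Finset.sum_sub_distrib]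
        simp [hP]
    _ ≤ (N : ℝ) ^ 2 / 16 * P := by
        have : (N - P) * P ≤ (N : ℝ) ^ 2 / 4 := by nlinarith [sq_nonneg ((N : ℝ) - 2 * P)]
        nlinarith [mul_le_mul_of_nonneg_right this hP0]
    _ = _ := by
        simp only [hP, t, cyc_three]
        rfl

end Counting

/-! ### Cyclic tuples and the gap polynomials -/

/-- The gap that a process lies in. -/
def gapIndex (s : Finset (Fin N)) (p : Fin N) : ℕ := cnt s p % s.card

/-- The tournament in terms of the numbers of the gaps. -/
def GapRel (a b : ℕ) : Prop := (a < b ∧ (a + b) % 2 = 1) ∨ (b < a ∧ (a + b) % 2 = 0)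

theorem cnt_le_card (s : Finset (Fin N)) (n : ℕ) : cnt s n ≤ s.card :=
  Finset.card_le_card (Finset.filter_subset _ _)

theorem gapIndex_eq (s : Finset (Fin N)) (p : Fin N) :
    (cnt s p = s.card ∧ gapIndex s p = 0) ∨ (cnt s p < s.card ∧ gapIndex s p = cnt s p) := by
  rcases (cnt_le_card s p).eq_or_lt with h | h
  · exact Or.inl ⟨h, by rw [gapIndex, h, Nat.mod_self]⟩
  · exact Or.inr ⟨h, Nat.mod_eq_of_lt h⟩

/-- Gap 0 consists of the processes with count 0 or `K`. Replacing `K` by 0 reverses the order and,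
`K` being odd, also the parity, so the relation is unaffected. -/
theorem rel_iff_gapRel {s : Finset (Fin N)} (hs : Odd s.card) {p q : Fin N}
    (h : gapIndex s p ≠ gapIndex s q) :
    Rel s p q ↔ GapRel (gapIndex s p) (gapIndex s q) := by
  have h1 : (p : ℕ) ≤ q → cnt s p ≤ cnt s q := fun h => cnt_mono s h
  have h2 : (q : ℕ) ≤ p → cnt s q ≤ cnt s p := fun h => cnt_mono s h
  rw [rel_iff, GapRel]
  rw [Nat.odd_iff] at hs
  have hp := gapIndex_eq s p
  have hq := gapIndex_eq s q
  have h3 : (p : ℕ) = q → gapIndex s p = gapIndex s q := fun h => by rw [Fin.ext h]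
  generalize gapIndex s p = a at *
  generalize gapIndex s q = b at *
  generalize cnt s p = c at *
  generalize cnt s q = d at *
  rcases lt_trichotomy (p : ℕ) q with hpq | hpq | hpq
  · have := h1 hpq.le
    rcases hp with ⟨h4, rfl⟩ | ⟨h4, rfl⟩ <;> rcases hq with ⟨h5, rfl⟩ | ⟨h5, rfl⟩ <;> omega
  · exact absurd (h3 hpq) h
  · have := h2 hpq.le
    rcases hp with ⟨h4, rfl⟩ | ⟨h4, rfl⟩ <;> rcases hq with ⟨h5, rfl⟩ | ⟨h5, rfl⟩ <;> omega

/-- Processes in one gap are ordered linearly by the tournament, and a vertex in another gap relates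
to all of them alike. -/
theorem Tri.gapIndex_ne {s : Finset (Fin N)} (hs : Odd s.card) {p q r : Fin N}
    (h : Tri s p q r) : gapIndex s p ≠ gapIndex s q := by
  intro he
  by_cases hr : gapIndex s r = gapIndex s p
  · obtain ⟨h1, h2, h3⟩ := h
    have m1 : (p : ℕ) ≤ q → cnt s p ≤ cnt s q := fun h => cnt_mono s h
    have m2 : (q : ℕ) ≤ p → cnt s q ≤ cnt s p := fun h => cnt_mono s h
    have m3 : (p : ℕ) ≤ r → cnt s p ≤ cnt s r := fun h => cnt_mono s h
    have m4 : (r : ℕ) ≤ p → cnt s r ≤ cnt s p := fun h => cnt_mono s h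
    have m5 : (q : ℕ) ≤ r → cnt s q ≤ cnt s r := fun h => cnt_mono s h
    have m6 : (r : ℕ) ≤ q → cnt s r ≤ cnt s q := fun h => cnt_mono s h
    have hp := gapIndex_eq s p
    have hq := gapIndex_eq s q
    have hr' := gapIndex_eq s r
    rw [rel_iff] at h1 h2 h3
    rw [Nat.odd_iff] at hs
    generalize gapIndex s p = a at *
    generalize gapIndex s q = b at *
    generalize gapIndex s r = c at *
    generalize cnt s p = d at *
    generalize cnt s q = e at *
    generalize cnt s r = f at *
    subst he hr
    rcases hp with ⟨h4, h4'⟩ | ⟨h4, h4'⟩ <;> rcases hq with ⟨h5, h5'⟩ | ⟨h5, h5'⟩ <;>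
      rcases hr' with ⟨h6, h6'⟩ | ⟨h6, h6'⟩ <;> omega
  · have h1 := (rel_iff_gapRel hs hr).1 h.2.2
    rw [he] at hr h1
    exact h.2.1.asymm ((rel_iff_gapRel hs hr).2 h1)

theorem tri_iff_gapRel {s : Finset (Fin N)} (hs : Odd s.card) {p q r : Fin N} :
    Tri s p q r ↔ GapRel (gapIndex s p) (gapIndex s q) ∧ GapRel (gapIndex s q) (gapIndex s r) ∧
      GapRel (gapIndex s r) (gapIndex s p) := by
  have hne : ∀ {a b}, GapRel a b → a ≠ b := by
    intro a b h
    unfold GapRel at h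
    omega
  constructor
  · intro h
    exact ⟨(rel_iff_gapRel hs (h.gapIndex_ne hs)).1 h.1,
      (rel_iff_gapRel hs (h.rotate.gapIndex_ne hs)).1 h.2.1,
      (rel_iff_gapRel hs (h.rotate.rotate.gapIndex_ne hs)).1 h.2.2⟩
  · rintro ⟨h1, h2, h3⟩
    exact ⟨(rel_iff_gapRel hs (hne h1)).2 h1, (rel_iff_gapRel hs (hne h2)).2 h2,
      (rel_iff_gapRel hs (hne h3)).2 h3⟩

/-- The tuples of processes whose gaps are numbered increasingly and with odd differences. -/
def Alt {m : ℕ} (s : Finset (Fin N)) (q : Fin m → Fin N) : Prop :=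
  ∀ j k : Fin m, (k : ℕ) = (j : ℕ) + 1 → gapIndex s (q j) < gapIndex s (q k) ∧
    Odd (gapIndex s (q k) - gapIndex s (q j))

/-- The numbers `m` for which alternating tuples of length `m` are those cyclic tuples that start in
the gap with the least number. -/
structure AltIffCyc (m : ℕ) [NeZero m] (s : Finset (Fin N)) : Prop where
  cyc : ∀ q : Fin m → Fin N, Alt s q → Cyc s q
  alt : ∀ q : Fin m → Fin N, Cyc s q → (∀ j, gapIndex s (q 0) ≤ gapIndex s (q j)) → Alt s q
  min : ∀ q : Fin m → Fin N, Alt s q → ∀ j, j ≠ 0 → gapIndex s (q 0) < gapIndex s (q j)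

theorem Alt.step {m : ℕ} {s : Finset (Fin N)} {q : Fin m → Fin N} (h : Alt s q) {j k : Fin m}
    (hjk : (k : ℕ) = (j : ℕ) + 1) : gapIndex s (q j) < gapIndex s (q k) ∧
      (gapIndex s (q j) + gapIndex s (q k)) % 2 = 1 := by
  obtain ⟨h1, h2⟩ := h j k hjk
  rw [Nat.odd_iff] at h2
  omega

theorem altIffCyc_three {s : Finset (Fin N)} (hs : Odd s.card) : AltIffCyc 3 s where
  cyc q h := by
    have h0 := h.step (j := 0) (k := 1) rfl
    have h1 := h.step (j := 1) (k := 2) rfl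
    rw [cyc_three, tri_iff_gapRel hs]
    unfold GapRel
    omega
  alt q h hmin := by
    rw [cyc_three, tri_iff_gapRel hs] at h
    have m1 := hmin 1
    have m2 := hmin 2
    unfold GapRel at h
    intro j k hjk
    rw [Nat.odd_iff]
    fin_cases j <;> fin_cases k <;> simp at hjk <;> simp only [Fin.zero_eta, Fin.mk_one,
      Fin.reduceFinMk] <;> omega
  min q h j hj := by
    have h0 := h.step (j := 0) (k := 1) rfl
    have h1 := h.step (j := 1) (k := 2) rfl
    fin_cases j
    · exact absurd rfl hj
    · exact h0.1
    · exact h0.1.trans h1.1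

theorem altIffCyc_five {s : Finset (Fin N)} (hs : Odd s.card) : AltIffCyc 5 s where
  cyc q h i := by
    have h0 := h.step (j := 0) (k := 1) rfl
    have h1 := h.step (j := 1) (k := 2) rfl
    have h2 := h.step (j := 2) (k := 3) rfl
    have h3 := h.step (j := 3) (k := 4) rfl
    rw [tri_iff_gapRel hs]
    unfold GapRel
    fin_cases i <;> simp only [Fin.zero_eta, Fin.mk_one, Fin.reduceFinMk, Fin.reduceAdd,
      zero_add] <;> omega
  alt q h hmin := by
    have h0 : Tri s (q 0) (q 1) (q 2) := h 0
    have h1 : Tri s (q 1) (q 2) (q 3) := h 1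
    have h2 : Tri s (q 2) (q 3) (q 4) := h 2
    have h3 : Tri s (q 3) (q 4) (q 0) := h 3
    rw [tri_iff_gapRel hs] at h0 h1 h2 h3
    have m1 := hmin 1
    have m2 := hmin 2
    have m3 := hmin 3
    have m4 := hmin 4
    have e1 := h0.1
    have e2 := h0.2.2
    have e3 := h3.2.2
    have e4 := h3.2.1
    have e5 := h0.2.1
    have e6 := h1.2.1
    have e7 := h2.2.1
    clear h0 h1 h2 h3 hmin h
    unfold GapRel at e1 e2 e3 e4 e5 e6 e7
    -- By minimality of gap `q 0`, its relations to the others fix all parities. Consecutive entries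
    -- then differ by odd numbers, which forces `GapRel` to mean increase.
    replace e1 : gapIndex s (q 0) < gapIndex s (q 1) ∧
      (gapIndex s (q 0) + gapIndex s (q 1)) % 2 = 1 := by omega
    replace e2 : (gapIndex s (q 0) + gapIndex s (q 2)) % 2 = 0 := by omega
    replace e3 : (gapIndex s (q 0) + gapIndex s (q 3)) % 2 = 1 := by omega
    replace e4 : (gapIndex s (q 0) + gapIndex s (q 4)) % 2 = 0 := by omega
    intro j k hjk
    rw [Nat.odd_iff]
    fin_cases j <;> fin_cases k <;> simp at hjk <;> simp only [Fin.zero_eta, Fin.mk_one,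
      Fin.reduceFinMk] <;> omega
  min q h j hj := by
    have h0 := (h.step (j := 0) (k := 1) rfl).1
    have h1 := (h.step (j := 1) (k := 2) rfl).1
    have h2 := (h.step (j := 2) (k := 3) rfl).1
    have h3 := (h.step (j := 3) (k := 4) rfl).1
    fin_cases j
    · exact absurd rfl hj
    · exact h0
    · exact h0.trans h1
    · exact (h0.trans h1).trans h2
    · exact ((h0.trans h1).trans h2).trans h3

section Counting

open scoped Classical

/-- Exactly one of the `m` rotations of a cyclic tuple is alternating: the one that starts in the
gap with the least number. -/
theorem cycCount_eq {m : ℕ} [NeZero m] {s : Finset (Fin N)} (H : AltIffCyc m s) :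
    cycCount m s = m * ∑ q : Fin m → Fin N, if Alt s q then (1 : ℝ) else 0 := by
  have h1 : ∀ q : Fin m → Fin N, (if Cyc s q then (1 : ℝ) else 0)
      = ∑ k : Fin m, if Alt s (fun i => q (i + k)) then (1 : ℝ) else 0 := by
    intro q
    split_ifs with hq
    · obtain ⟨k, hk⟩ := Finite.exists_min (fun k => gapIndex s (q k))
      have halt : Alt s (fun i => q (i + k)) :=
        H.alt _ (hq.rotate k) (fun j => by simpa using hk (j + k))
      rw [Finset.sum_eq_single k, if_pos halt]
      · intro k' _ hne
        rw [if_neg]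
        intro halt'
        have a := H.min _ halt (k' - k) (sub_ne_zero.2 hne)
        have b := H.min _ halt' (k - k') (sub_ne_zero.2 (Ne.symm hne))
        simp only [zero_add, sub_add_cancel] at a b
        exact lt_asymm a b
      · simp
    · symm
      refine Finset.sum_eq_zero fun k _ => if_neg fun h => hq ?_
      exact (cyc_rotate k).1 (H.cyc _ h)
  rw [cycCount, Finset.sum_congr rfl fun q _ => h1 q, Finset.sum_comm,
    Finset.sum_congr rfl fun k _ => sum_rotate k (fun q => if Alt s q then (1 : ℝ) else 0)]
  simp

theorem cnt_le_iff (z : Config N) (i : Fin z.K) (n : ℕ) :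
    cnt z.tokens n ≤ i ↔ n ≤ z.pos i := by
  have h : cnt z.tokens n = (Finset.univ.filter (fun j : Fin z.K => (z.pos j : ℕ) < n)).card := by
    have : z.tokens = Finset.univ.map z.pos.toEmbedding := by
      exact (Finset.map_orderEmbOfFin_univ z.tokens rfl).symm
    rw [cnt, this, Finset.filter_map, Finset.card_map]
    rfl
  rw [h]
  constructor
  · intro hle
    by_contra! hlt
    have : Finset.Iic i ⊆ Finset.univ.filter (fun j : Fin z.K => (z.pos j : ℕ) < n) := by
      intro j hj
      rw [Finset.mem_Iic] at hj
      have : (z.pos j : ℕ) ≤ z.pos i := z.pos.monotone hj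
      simpa using lt_of_le_of_lt this hlt
    have := Finset.card_le_card this
    rw [Fin.card_Iic] at this
    omega
  · intro hle
    have : Finset.univ.filter (fun j : Fin z.K => (z.pos j : ℕ) < n) ⊆ Finset.Iio i := by
      intro j hj
      simp only [Finset.mem_filter, Finset.mem_univ, true_and] at hj
      rw [Finset.mem_Iio]
      have : z.pos j < z.pos i := Fin.lt_def.2 (hj.trans_le hle)
      exact z.pos.lt_iff_lt.1 this
    have := Finset.card_le_card this
    rwa [Fin.card_Iio] at this

theorem card_gapIndex_eq (z : Config N) (i : Fin z.K) :
    (Finset.univ.filter (fun p : Fin N => gapIndex z.tokens p = i)).card = z.gap i := by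
  have hi := i.2
  have hg := fun p => gapIndex_eq z.tokens p
  have hK : z.K = z.tokens.card := rfl
  unfold Config.gap
  split_ifs with h0
  · have h1 := cnt_le_iff z ⟨0, z.odd_K.pos⟩
    have h2 := cnt_le_iff z ⟨z.K - 1, Nat.sub_lt z.odd_K.pos one_pos⟩
    have h3 : z.pos ⟨0, z.odd_K.pos⟩ ≤ z.pos ⟨z.K - 1, Nat.sub_lt z.odd_K.pos one_pos⟩ :=
      z.pos.monotone (Fin.mk_le_mk.2 (Nat.zero_le _))
    generalize z.pos ⟨0, _⟩ = a at *
    generalize z.pos ⟨z.K - 1, _⟩ = b at *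
    simp only at h1 h2
    have : Finset.univ.filter (fun p : Fin N => gapIndex z.tokens p = i)
        = Finset.Iic a ∪ Finset.Ioi b := by
      ext p
      have := hg p
      have := h1 p
      have := h2 p
      simp only [Finset.mem_filter, Finset.mem_univ, true_and, Finset.mem_union, Finset.mem_Iic,
        Finset.mem_Ioi, Fin.le_def, Fin.lt_def]
      omega
    rw [this, Finset.card_union_of_disjoint, Fin.card_Iic, Fin.card_Ioi]
    · have := b.2
      have := Fin.le_def.1 h3
      omega
    · rw [Finset.disjoint_left]
      intro x hx hx'
      rw [Finset.mem_Iic] at hx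
      rw [Finset.mem_Ioi] at hx'
      exact absurd (hx.trans h3) (not_le.2 hx')
  · have h1 := cnt_le_iff z i
    have h2 := cnt_le_iff z ⟨(i : ℕ) - 1, lt_of_le_of_lt (Nat.sub_le _ _) i.isLt⟩
    generalize z.pos ⟨(i : ℕ) - 1, _⟩ = b at *
    simp only at h2
    have : Finset.univ.filter (fun p : Fin N => gapIndex z.tokens p = i)
        = Finset.Ioc b (z.pos i) := by
      ext p
      have := hg p
      have := h1 p
      have := h2 p
      simp only [Finset.mem_filter, Finset.mem_univ, true_and, Finset.mem_Ioc, Fin.le_def,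
        Fin.lt_def]
      omega
    rw [this, Fin.card_Ioc]

/-- A product of gap lengths counts the ways to choose one process in each of the gaps. -/
theorem alternatingSum_gap (m : ℕ) (z : Config N) :
    alternatingSum m z.K (fun i => (z.gap i : ℝ))
      = ∑ q : Fin m → Fin N, if Alt z.tokens q then (1 : ℝ) else 0 := by
  have hlt : ∀ p, gapIndex z.tokens p < z.K := fun p => Nat.mod_lt _ z.odd_K.pos
  let γ : Fin N → Fin z.K := fun p => ⟨gapIndex z.tokens p, hlt p⟩
  have h1 : ∀ i : Fin z.K, (z.gap i : ℝ) = ∑ p : Fin N, if γ p = i then (1 : ℝ) else 0 := by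
    intro i
    rw [Finset.sum_boole, ← card_gapIndex_eq]
    simp only [γ, Fin.ext_iff]
  have h2 : ∀ i : Fin m → Fin z.K, ∏ j, (z.gap (i j) : ℝ)
      = ∑ q : Fin m → Fin N, if (fun j => γ (q j)) = i then (1 : ℝ) else 0 := by
    intro i
    simp only [h1]
    rw [Finset.prod_univ_sum, Fintype.piFinset_univ]
    refine Finset.sum_congr rfl fun q _ => ?_
    rw [Finset.prod_ite_zero]
    simp [funext_iff]
  unfold alternatingSum
  simp only [h2]
  rw [Finset.sum_comm]
  refine Finset.sum_congr rfl fun q _ => ?_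
  rw [Finset.sum_ite_eq]
  refine if_congr ?_ rfl rfl
  simp only [Finset.mem_filter, Finset.mem_univ, true_and]
  rfl

theorem alternatingSum_div (m K : ℕ) (x : Fin K → ℝ) (c : ℝ) :
    alternatingSum m K (fun i => x i / c) = alternatingSum m K x / c ^ m := by
  unfold alternatingSum
  rw [Finset.sum_div]
  refine Finset.sum_congr rfl fun i _ => ?_
  rw [Finset.prod_div_distrib]
  simp

theorem V_eq (hN : N ≠ 0) (z : Config N) : V z = 4 / (3 * N) * cycCount 3 z.tokens
    - 96 / (5 * (N : ℝ) ^ 3) * cycCount 5 z.tokens := by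
  have hN' : (N : ℝ) ≠ 0 := Nat.cast_ne_zero.2 hN
  have h3 := cycCount_eq (altIffCyc_three z.odd_K)
  have h5 := cycCount_eq (altIffCyc_five z.odd_K)
  rw [← alternatingSum_gap] at h3 h5
  unfold V f f₃ f₅
  rw [alternatingSum_div, alternatingSum_div, h3, h5]
  push_cast
  field_simp
  ring

end Counting

/-! ### Nonnegativity and drift of `V` -/

theorem successorExpectation_eq (z : Config N) (W : Config N → ℝ) :
    z.successorExpectation W = (∑ b : Fin N → Bool, W (z.step b)) / 2 ^ N := by
  rw [Config.successorExpectation, coins, PMF.integral_eq_sum]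
  simp [PMF.uniformOfFintype_apply, ← Finset.mul_sum, div_eq_inv_mul]

theorem V_nonneg (hN : N ≠ 0) (z : Config N) : 0 ≤ V z := by
  have h := cycCount_five_le z.tokens
  have h0 := cycCount_nonneg 3 z.tokens
  have hN' : (0 : ℝ) < N := Nat.cast_pos.2 (Nat.pos_of_ne_zero hN)
  rw [V_eq hN, sub_nonneg]
  calc _ ≤ 96 / (5 * (N : ℝ) ^ 3) * ((N : ℝ) ^ 2 / 16 * cycCount 3 z.tokens) :=
        mul_le_mul_of_nonneg_left h (by positivity)
    _ = 6 / (5 * (N : ℝ)) * cycCount 3 z.tokens := by field_simp; ring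
    -- This is `6/5 ≤ 4/3`.
    _ ≤ _ := by
        refine mul_le_mul_of_nonneg_right ?_ h0
        rw [div_le_div_iff₀ (by positivity) (by positivity)]
        linarith

theorem successorExpectation_V_le (hN : 2 ≤ N) (z : Config N) :
    z.successorExpectation V ≤ V z - ((z.K : ℝ) - 1) / 2
      + 4 / (N : ℝ) ^ 3 * (((z.K : ℝ) - 3) * cycCount 3 z.tokens) := by
  have hN0 : N ≠ 0 := by omega
  have hN' : (0 : ℝ) < N := Nat.cast_pos.2 (Nat.pos_of_ne_zero hN0)
  have h2 : (0 : ℝ) < 2 ^ N := by positivity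
  have h3 := sum_cycCount_three_stepSet_le z.odd_K
  have h5 := le_sum_cycCount_five_stepSet hN z.odd_K
  have a3 := le_adjCount_three hN z.odd_K
  have a5 := adjCount_five_le hN z.odd_K
  change (N : ℝ) * (((z.K : ℝ) - 1) / 2) ≤ _ at a3
  change _ ≤ ((z.K : ℝ) - 3) / 6 * _ at a5
  have hsum : ∑ b : Fin N → Bool, V (z.step b)
      = 4 / (3 * N) * (∑ b : Fin N → Bool, cycCount 3 (stepSet z.tokens b))
        - 96 / (5 * (N : ℝ) ^ 3) * ∑ b : Fin N → Bool, cycCount 5 (stepSet z.tokens b) := by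
    rw [Finset.mul_sum, Finset.mul_sum, ← Finset.sum_sub_distrib]
    exact Finset.sum_congr rfl fun b _ => V_eq hN0 _
  rw [successorExpectation_eq, div_le_iff₀ h2, hsum, V_eq hN0]
  have b3 : ∑ b : Fin N → Bool, cycCount 3 (stepSet z.tokens b)
      ≤ 2 ^ N * (cycCount 3 z.tokens - 3 / 4 * ((N : ℝ) * (((z.K : ℝ) - 1) / 2))) :=
    h3.trans (mul_le_mul_of_nonneg_left (by linarith) h2.le)
  have b5 : 2 ^ N * (cycCount 5 z.tokens - 5 / 4 * (((z.K : ℝ) - 3) / 6 * cycCount 3 z.tokens))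
      ≤ ∑ b : Fin N → Bool, cycCount 5 (stepSet z.tokens b) :=
    le_trans (mul_le_mul_of_nonneg_left (by linarith) h2.le) h5
  refine (sub_le_sub (mul_le_mul_of_nonneg_left b3 (by positivity))
    (mul_le_mul_of_nonneg_left b5 (by positivity))).trans (le_of_eq ?_)
  field_simp
  ring

theorem successorExpectation_V_le_sub_one (hN : 2 ≤ N) (z : Config N) (hz : 3 ≤ z.K) :
    z.successorExpectation V ≤ V z - 1 := by
  have h := successorExpectation_V_le hN z
  have h3 := cycCount_three_le z.tokens
  have hK : (3 : ℝ) ≤ z.K := by exact_mod_cast hz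
  have hN' : (0 : ℝ) < N := Nat.cast_pos.2 (by omega)
  have : 4 / (N : ℝ) ^ 3 * (((z.K : ℝ) - 3) * cycCount 3 z.tokens) ≤ ((z.K : ℝ) - 3) / 2 := by
    calc _ ≤ 4 / (N : ℝ) ^ 3 * (((z.K : ℝ) - 3) * ((N : ℝ) ^ 3 / 8)) :=
          mul_le_mul_of_nonneg_left (mul_le_mul_of_nonneg_left h3 (by linarith)) (by positivity)
      _ = _ := by field_simp; ring
  linarith

/-- Needed because the process keeps running after stabilization. At `K = 1` both correction terms
of the drift bound are at most 0. -/
theorem successorExpectation_V_le_self (hN : 2 ≤ N) (z : Config N) (hz : z.K = 1) :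
    z.successorExpectation V ≤ V z := by
  have h := successorExpectation_V_le hN z
  have h3 := cycCount_nonneg 3 z.tokens
  have : 0 ≤ 4 / (N : ℝ) ^ 3 * cycCount 3 z.tokens := by positivity
  rw [hz] at h
  push_cast at h
  linarith

/-! ### From the drift to the expected stabilization time -/

instance : MeasurableSpace (Config N) := ⊤

instance : DiscreteMeasurableSpace (Config N) := ⟨fun _ => trivial⟩

instance : Finite (Config N) := inferInstanceAs (Finite {s : Finset (Fin N) // Odd s.card})

instance : IsProbabilityMeasure (coinSequence N) := by
  unfold coinSequence; infer_instance

theorem measurable_process (z : Config N) (t : ℕ) : Measurable (fun ω => z.process ω t) := by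
  induction t with
  | zero => exact measurable_const
  | succ t ih =>
    have h : Measurable (fun y : Config N × (Fin N → Bool) => y.1.step y.2) :=
      Measurable.of_discrete
    have hω : Measurable (fun ω : ℕ → Fin N → Bool => ω t) := measurable_pi_apply t
    have h' := h.comp (ih.prodMk hω)
    exact h'

theorem process_congr (z : Config N) {ω ω' : ℕ → Fin N → Bool} {t : ℕ}
    (h : ∀ i < t, ω i = ω' i) : z.process ω t = z.process ω' t := by
  induction t with
  | zero => rfl
  | succ t ih =>
    change (z.process ω t).step (ω t) = (z.process ω' t).step (ω' t)
    rw [ih fun i hi => h i (by omega), h t (by omega)]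

theorem indepFun_process (z : Config N) (t : ℕ) :
    ProbabilityTheory.IndepFun (fun ω => z.process ω t) (fun ω => ω t) (coinSequence N) := by
  have h : ProbabilityTheory.iIndepFun (fun (i : ℕ) (ω : ℕ → Fin N → Bool) => ω i)
      (coinSequence N) :=
    ProbabilityTheory.iIndepFun_infinitePi (P := fun _ : ℕ => coins N)
      (X := fun (_ : ℕ) (x : Fin N → Bool) => x) (fun _ => measurable_id)
  have h2 := h.indepFun_finset (Finset.range t) {t} (by simp) (fun i => measurable_pi_apply i)
  -- The state at time `t` depends only on the rounds before `t`; the later ones are filled with a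
  -- dummy value.
  let φ : ((Finset.range t) → Fin N → Bool) → Config N := fun y =>
    z.process (fun i => if hi : i ∈ Finset.range t then y ⟨i, hi⟩ else fun _ => false) t
  have h3 := h2.comp (φ := φ) (ψ := fun y => y ⟨t, Finset.mem_singleton_self t⟩)
    Measurable.of_discrete Measurable.of_discrete
  convert h3 using 1
  · funext ω
    refine process_congr z fun i hi => ?_
    simp [hi]
  · rfl

theorem map_process_prod (z : Config N) (t : ℕ) :
    (coinSequence N).map (fun ω => (z.process ω t, ω t))
      = ((coinSequence N).map (fun ω => z.process ω t)).prod (coins N) := by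
  have h := (ProbabilityTheory.indepFun_iff_map_prod_eq_prod_map_map
    (measurable_process z t).aemeasurable (measurable_pi_apply t).aemeasurable).1
    (indepFun_process z t)
  rw [h]
  congr 1
  exact Measure.infinitePi_map_eval (fun _ : ℕ => coins N) t

theorem lintegral_V_step_le (hN : 2 ≤ N) (w : Config N) :
    ∫⁻ b, ENNReal.ofReal (V (w.step b)) ∂(coins N) + (if w.K = 1 then 0 else 1)
      ≤ ENNReal.ofReal (V w) := by
  have h0 : ∀ w : Config N, 0 ≤ V w := V_nonneg (by omega)
  have hS : 0 ≤ w.successorExpectation V := integral_nonneg fun b => h0 _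
  have h1 : ∫⁻ b, ENNReal.ofReal (V (w.step b)) ∂(coins N)
      = ENNReal.ofReal (w.successorExpectation V) :=
    (ofReal_integral_eq_lintegral_ofReal Integrable.of_finite
      (Filter.Eventually.of_forall fun b => h0 _)).symm
  rw [h1]
  split_ifs with hw
  · rw [add_zero]
    exact ENNReal.ofReal_le_ofReal (successorExpectation_V_le_self hN w hw)
  · have hK : 3 ≤ w.K := by
      have := Nat.odd_iff.1 w.odd_K
      omega
    rw [← ENNReal.ofReal_one, ← ENNReal.ofReal_add hS zero_le_one]
    exact ENNReal.ofReal_le_ofReal (by linarith [successorExpectation_V_le_sub_one hN w hK])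

theorem lintegral_V_process_succ_le (hN : 2 ≤ N) (z : Config N) (t : ℕ) :
    ∫⁻ ω, ENNReal.ofReal (V (z.process ω (t + 1))) ∂(coinSequence N)
      + ∫⁻ ω, (if (z.process ω t).K = 1 then 0 else 1) ∂(coinSequence N)
      ≤ ∫⁻ ω, ENNReal.ofReal (V (z.process ω t)) ∂(coinSequence N) := by
  have h1 : ∫⁻ ω, ENNReal.ofReal (V (z.process ω (t + 1))) ∂(coinSequence N)
      = ∫⁻ ω, ∫⁻ b, ENNReal.ofReal (V ((z.process ω t).step b)) ∂(coins N) ∂(coinSequence N) := by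
    let F : Config N × (Fin N → Bool) → ℝ≥0∞ := fun y => ENNReal.ofReal (V (y.1.step y.2))
    have hF : Measurable F := Measurable.of_discrete
    have e1 : ∫⁻ ω, F (z.process ω t, ω t) ∂(coinSequence N)
        = ∫⁻ y, F y ∂((coinSequence N).map (fun ω => (z.process ω t, ω t))) :=
      (lintegral_map hF ((measurable_process z t).prodMk (measurable_pi_apply t))).symm
    have e2 : ∫⁻ w, ∫⁻ b, F (w, b) ∂(coins N) ∂((coinSequence N).map (fun ω => z.process ω t))
        = ∫⁻ ω, ∫⁻ b, F (z.process ω t, b) ∂(coins N) ∂(coinSequence N) :=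
      lintegral_map Measurable.of_discrete (measurable_process z t)
    rw [map_process_prod, lintegral_prod _ hF.aemeasurable, e2] at e1
    exact e1
  have hm : Measurable (fun ω => if (z.process ω t).K = 1 then (0 : ℝ≥0∞) else 1) :=
    (Measurable.of_discrete (f := fun w : Config N => if w.K = 1 then (0 : ℝ≥0∞) else 1)).comp
      (measurable_process z t)
  rw [h1, ← lintegral_add_right _ hm]
  exact lintegral_mono fun ω => lintegral_V_step_le hN _

/-- The sum counts all times with more than one token, and is infinite if the process never
stabilizes. -/
theorem stabilizationTime_le_tsum (z : Config N) (ω : ℕ → Fin N → Bool) :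
    z.stabilizationTime ω ≤ ∑' t, if (z.process ω t).K = 1 then (0 : ℝ≥0∞) else 1 := by
  by_cases h : ∃ t, (z.process ω t).K = 1
  · classical
    calc z.stabilizationTime ω ≤ (Nat.find h : ℝ≥0∞) :=
        iInf₂_le (f := fun (t : ℕ) (_ : (z.process ω t).K = 1) => (t : ℝ≥0∞)) _ (Nat.find_spec h)
      _ = ∑ t ∈ Finset.range (Nat.find h),
          if (z.process ω t).K = 1 then (0 : ℝ≥0∞) else 1 := by
        rw [Finset.sum_congr rfl fun t ht => if_neg (Nat.find_min h (Finset.mem_range.1 ht))]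
        simp
      _ ≤ _ := ENNReal.sum_le_tsum _
  · push Not at h
    simp only [h, if_false]
    rw [ENNReal.tsum_const_eq_top_of_ne_zero one_ne_zero]
    exact le_top

theorem expectedTime_le (hN : 2 ≤ N) (z : Config N) :
    z.expectedTime ≤ ENNReal.ofReal (V z) := by
  have hm : ∀ t, Measurable (fun ω => if (z.process ω t).K = 1 then (0 : ℝ≥0∞) else 1) := fun t =>
    (Measurable.of_discrete (f := fun w : Config N => if w.K = 1 then (0 : ℝ≥0∞) else 1)).comp
      (measurable_process z t)
  -- Telescoping the drift inequality; the nonnegative term at time `n` is dropped afterwards.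
  have key : ∀ n, ∫⁻ ω, ENNReal.ofReal (V (z.process ω n)) ∂(coinSequence N)
      + ∑ t ∈ Finset.range n, ∫⁻ ω, (if (z.process ω t).K = 1 then (0 : ℝ≥0∞) else 1)
        ∂(coinSequence N) ≤ ENNReal.ofReal (V z) := by
    intro n
    induction n with
    | zero => simp [Config.process]
    | succ n ih =>
      rw [Finset.sum_range_succ, add_comm (∑ t ∈ Finset.range n, _), ← add_assoc]
      exact (add_le_add_left (lintegral_V_process_succ_le hN z n) _).trans ih
  calc z.expectedTime
      ≤ ∫⁻ ω, ∑' t, (if (z.process ω t).K = 1 then (0 : ℝ≥0∞) else 1) ∂(coinSequence N) :=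
        lintegral_mono fun ω => stabilizationTime_le_tsum z ω
    _ = ∑' t, ∫⁻ ω, (if (z.process ω t).K = 1 then (0 : ℝ≥0∞) else 1) ∂(coinSequence N) :=
        lintegral_tsum fun t => (hm t).aemeasurable
    _ ≤ _ := ENNReal.tsum_le_of_sum_range_le fun n => le_add_self.trans (key n)

end Herman


theorem mainTheorem2 (N : ℕ) (hN : 3 ≤ N) :
    (∀ z : Herman.Config N, 0 ≤ Herman.V z) ∧
    (∀ z : Herman.Config N, 3 ≤ z.K → z.successorExpectation Herman.V ≤ Herman.V z - 1) ∧
    (∀ z : Herman.Config N, z.expectedTime ≤ ENNReal.ofReal (Herman.V z)) :=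
  ⟨Herman.V_nonneg (by omega), Herman.successorExpectation_V_le_sub_one (by omega),
    Herman.expectedTime_le (by omega)⟩
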